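/- **Setting.** Let $f(x)=\frac1N\sum_{i=1}^N f_i(x)$ on $\mathbb R^n$ with $f_i$ convex and differentiable, let $\mathcal G_1,\dots,\mathcal G_k$ be a partition of the coordinates, let $g(x)=\sum_{j=1}^k g_j(x_{\mathcal G_j})$ with $g_j$ closed, convex, with values in $\mathbb R\cup\{\infty\}$, and let $F=f+g$. Assume that the set $S$ of minimizers of $F$ (with finite value) is nonempty; $F^*$ is the minimum and $\mathcal P_S$ the Euclidean projection onto $S$. Let $L_{nor},L_{res}$ and $L_{\max}>0$ be constants such that for all $i$, all $x,y$, all blocks $j$ and all $\Delta$ supported on $\mathcal G_j$: $\|\nabla f_i(x)-\nabla f_i(y)\|\le L_{nor}\|x-y\|$, $\|\nabla f_i(x+\Delta)-\nabla f_i(x)\|\le L_{res}\|\Delta\|$, and $\max_{j'}\|(\nabla f_i(x+\Delta)-\nabla f_i(x))_{\mathcal G_{j'}}\|\le L_{\max}\|\Delta\|$. Put $\Lambda_{res}=L_{res}/L_{\max}$, $\Lambda_{nor}=L_{nor}/L_{\max}$. **Algorithm (AsySBCDVR).** Given $x^0$ with $F(x^0)<\infty$, step size $\gamma>0$, inner length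 $m$ and mini-batch size $1\le b\le N$, for $s=0,1,2,\dots$ set $\widetilde x=x_0=x^s$. For $t=0,\dots,m-1$: a vector $\widehat x_t$ is read, where $x_t=\widehat x_t+\sum_{t'\in K(t)}B_{t'}(x_{t'+1}-x_{t'})$ for some set $K(t)\subseteq\{t':0\le t'<t,\ t-t'\le\tau\}$ and nonzero diagonal $0$–$1$ matrices $B_{t'}$; a mini-batch $\mathcal B$ (a $b$-element subset of $\{1,\dots,N\}$) and a block $j$ are drawn uniformly, independently of each other and of the past including $\widehat x_t$; with $\widehat v=\frac1b\sum_{i\in\mathcal B}(\nabla f_i(\widehat x_t)-\nabla f_i(\widetilde x))+\nabla f(\widetilde x)$, the block $j$ is updated by $(x_{t+1})_{\mathcal G_j}=\mathrm{prox}_{\frac{\gamma}{L_{\max}}g_j}\big((x_t)_{\mathcal G_j}-\tfrac{\gamma}{L_{\max}}\widehat v_{\mathcal G_j}\big)$ and the other blocks are kept. Finally $x^{s+1}=x_m$. **Theorem.** Let $\rho>1$, $\theta_1=\frac{\rho^{1/2}-\rho^{(\tau+1)/2}}{1-\rho^{1/2}}$, $\theta_2=\frac{\rho^{1/2}-\rho^{m/2}}{1-\rho^{1/2}}$,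 $\theta'=\frac{\rho^{\tau+1}-\rho}{\rho-1}$, and suppose that $$4\gamma\big(\Lambda_{res}(1+\theta_1)+\Lambda_{nor}(1+\theta_2)\big)\le k^{1/2}(1-\rho^{-1})-4,$$ $$1-\Lambda_{nor}\gamma-\frac{\gamma\tau\theta'}{k}-\frac{2(\Lambda_{res}\theta_1+\Lambda_{nor}\theta_2)\gamma}{k^{1/2}}\ge 0 .$$ Then $F(x^s)$ is almost surely finite and integrable for every $s\ge0$, and: 1. If $f$ is optimally strongly convex with parameter $l>0$, that is, $F(x)-F(\mathcal P_S(x))\ge\frac l2\|x-\mathcal P_S(x)\|^2$ for all $x$, then for all $s\ge0$ $$\mathbb E F(x^s)-F^*\le\frac{L_{\max}}{2\gamma}\Big(\frac1{1+\frac{m\gamma l}{k(l\gamma+L_{\max})}}\Big)^{s}\Big(\|x^0-\mathcal P_S(x^0)\|^2+\frac{2\gamma}{L_{\max}}(F(x^0)-F^*)\Big).$$ 2. In general (each $f_i$ only smooth and convex), for all $s\ge0$ $$\mathbb E F(x^s)-F^*\le\frac{kL_{\max}\|x^0-\mathcal P_S(x^0)\|^2+2\gamma k\,(F(x^0)-F^*)}{2\gamma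 k+2m\gamma s}.$$ -/

import Mathlib

open MeasureTheory

noncomputable section

namespace AsySBCDVR

/-- `ℝⁿ` with the Euclidean norm. -/
abbrev Vec (n : ℕ) : Type := EuclideanSpace ℝ (Fin n)

/-- The data of `min F(x) = f(x) + g(x)` on `ℝⁿ`: a partition of the coordinates into `k` blocks
(`block c` is the block that contains the coordinate `c`), smooth convex components `f i`
(`i` in `Fin N`) with `f = (1/N) ∑ i, f i`, and closed convex extended-valued block functions `g j`
with `g(x) = ∑ j, g j (x_{G_j})`. -/
structure Problem (n k N : ℕ) where
  block : Fin n → Fin k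
  f : Fin N → Vec n → ℝ
  g : (j : Fin k) → EuclideanSpace ℝ {c : Fin n // block c = j} → EReal
  f_differentiable : ∀ i, Differentiable ℝ (f i)
  f_convex : ∀ i, ConvexOn ℝ Set.univ (f i)
  g_ne_bot : ∀ j z, g j z ≠ ⊥
  g_closed : ∀ j, LowerSemicontinuous (g j)
  g_convex : ∀ j, Convex ℝ {p : EuclideanSpace ℝ {c : Fin n // block c = j} × ℝ | g j p.1 ≤ p.2}

/-- `z` is the proximal point of `u` for the function `c • h`, that is,
`z` minimizes `c * h w + ‖w - u‖² / 2` over `w`. -/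
def IsProx {V : Type*} [NormedAddCommGroup V] (c : ℝ) (h : V → EReal) (u z : V) : Prop :=
  ∀ w : V, (c : EReal) * h z + ((‖z - u‖ ^ 2 / 2 : ℝ) : EReal) ≤
    (c : EReal) * h w + ((‖w - u‖ ^ 2 / 2 : ℝ) : EReal)

/-- `p` is the Euclidean projection of `x` onto `S`. -/
def IsProj {V : Type*} [NormedAddCommGroup V] (S : Set V) (x p : V) : Prop :=
  p ∈ S ∧ ∀ q ∈ S, ‖x - p‖ ≤ ‖x - q‖

/-- An inconsistent (lock-free) read at inner iteration `t` with delay at most `τ`: the vector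
`zhat` differs from `z t` by masked updates,
`z t = zhat + ∑ t' ∈ K, B t' (z (t' + 1) - z t')`, with a set `K` of earlier iterations
not older than `τ` and nonzero diagonal 0-1 matrices `B t'`; a matrix is given by the finite set of
the coordinates where its diagonal entry is `1`. -/
def InconsistentRead {n : ℕ} (τ t : ℕ) (z : ℕ → Vec n) (zhat : Vec n) : Prop :=
  ∃ (K : Finset ℕ) (B : ℕ → Finset (Fin n)),
    (∀ t' ∈ K, t' < t ∧ t - t' ≤ τ ∧ (B t').Nonempty) ∧
    ∀ c, z t c = zhat c + ∑ t' ∈ K, if c ∈ B t' then z (t' + 1) c - z t' c else 0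

namespace Problem

variable {n k N : ℕ} (P : Problem n k N)

/-- The block `x_{G_j}` of the vector `x`. -/
def part (j : Fin k) (x : Vec n) : EuclideanSpace ℝ {c : Fin n // P.block c = j} :=
  WithLp.toLp 2 (fun c => x c.1)

/-- The objective `F = f + g`. -/
def F (x : Vec n) : EReal :=
  (((N : ℝ)⁻¹ * ∑ i, P.f i x : ℝ) : EReal) + ∑ j, P.g j (P.part j x)

/-- The optimal value `F*`, as a real number (it is finite as soon as `P.sol` is nonempty). -/
def Fstar : ℝ := (⨅ x, P.F x).toReal

/-- The solution set `S`. -/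
def sol : Set (Vec n) := {x | P.F x ≠ ⊤ ∧ P.F x = ⨅ y, P.F y}

/-- Optimal strong convexity with parameter `l`. -/
def OptStrongConvex (l : ℝ) : Prop :=
  ∀ x p, IsProj P.sol x p → P.F p + ((l / 2 * ‖x - p‖ ^ 2 : ℝ) : EReal) ≤ P.F x

/-- `L` is a normal Lipschitz constant of the gradients of the components. -/
def NormalLipschitz (L : ℝ) : Prop :=
  ∀ i x y, ‖gradient (P.f i) x - gradient (P.f i) y‖ ≤ L * ‖x - y‖

/-- The vector `d` vanishes outside the block `j`. -/
def SupportedOn (j : Fin k) (d : Vec n) : Prop := ∀ c, P.block c ≠ j → d c = 0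

/-- `L` is a block restricted Lipschitz constant: the whole gradient under a change of one block. -/
def BlockRestrictedLipschitz (L : ℝ) : Prop :=
  ∀ i j x d, P.SupportedOn j d →
    ‖gradient (P.f i) (x + d) - gradient (P.f i) x‖ ≤ L * ‖P.part j d‖

/-- `L` is a block coordinate Lipschitz constant: the largest block of the change of the gradient
under a change of one block. -/
def BlockCoordinateLipschitz (L : ℝ) : Prop :=
  ∀ i j x d, P.SupportedOn j d → ∀ j',
    ‖P.part j' (gradient (P.f i) (x + d) - gradient (P.f i) x)‖ ≤ L * ‖P.part j d‖

/-- The full gradient `∇ f`. -/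
def fullGrad (x : Vec n) : Vec n := (N : ℝ)⁻¹ • ∑ i, gradient (P.f i) x

/-- The variance-reduced stochastic gradient for the mini-batch `A`, the value `xhat` that was
read, and the snapshot `xtilde`. -/
def vhat (A : Finset (Fin N)) (xhat xtilde : Vec n) : Vec n :=
  (A.card : ℝ)⁻¹ • ∑ i ∈ A, gradient (P.f i) xhat
    - (A.card : ℝ)⁻¹ • ∑ i ∈ A, gradient (P.f i) xtilde + P.fullGrad xtilde

end Problem

/-- A run of the asynchronous proximal block coordinate descent with variance reduction.

* `xs s` is the outer iterate `x^s`; `x s t` is the `t`-th inner iterate of outer loop `s`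
  (`x s 0 = xs s`, `xs (s + 1) = x s m`), `xhat s t` the value read at that iteration.
* `batch s t` and `coord s t` are the mini-batch and the block drawn at that iteration.
* `ℱ r` is the information available after `r` inner iterations in total, so that inner iteration
  `t < m` of outer loop `s` is preceded by `ℱ (s * m + t)`. The reads may depend in any way on that
  past (and on extra randomness in it); the draw is uniform conditionally on it. -/
structure IsRun {n k N : ℕ} {Ω : Type*} {m₀ : MeasurableSpace Ω} (μ : Measure Ω)
    (ℱ : Filtration ℕ m₀) (P : Problem n k N) (Lmax γ : ℝ) (m τ b : ℕ) (x0 : Vec n)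
    (xs : ℕ → Ω → Vec n) (x xhat : ℕ → ℕ → Ω → Vec n)
    (batch : ℕ → ℕ → Ω → Finset (Fin N)) (coord : ℕ → ℕ → Ω → Fin k) : Prop where
  start : ∀ ω, xs 0 ω = x0
  inner_start : ∀ s ω, x s 0 ω = xs s ω
  outer_step : ∀ s ω, xs (s + 1) ω = x s m ω
  x_adapted : ∀ s t, t ≤ m → Measurable[ℱ (s * m + t)] (x s t)
  xhat_adapted : ∀ s t, t < m → Measurable[ℱ (s * m + t)] (xhat s t)
  read : ∀ s t, t < m → ∀ ω, InconsistentRead τ t (fun u => x s u ω) (xhat s t ω)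
  batch_card : ∀ s t, t < m → ∀ ω, (batch s t ω).card = b
  draw_measurable : ∀ s t, t < m → ∀ A j,
    MeasurableSet[ℱ (s * m + t + 1)] {ω | batch s t ω = A ∧ coord s t ω = j}
  draw_uniform : ∀ s t, t < m → ∀ C, MeasurableSet[ℱ (s * m + t)] C →
    ∀ (A : Finset (Fin N)) (j : Fin k), A.card = b →
      μ.real (C ∩ {ω | batch s t ω = A ∧ coord s t ω = j}) =
        μ.real C / ((N.choose b : ℝ) * (k : ℝ))
  update_block : ∀ s t, t < m → ∀ ω,
    IsProx (γ / Lmax) (P.g (coord s t ω))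
      (P.part (coord s t ω) (x s t ω)
        - (γ / Lmax) • P.part (coord s t ω) (P.vhat (batch s t ω) (xhat s t ω) (xs s ω)))
      (P.part (coord s t ω) (x s (t + 1) ω))
  update_off : ∀ s t, t < m → ∀ ω c, P.block c ≠ coord s t ω → x s (t + 1) ω c = x s t ω c

/-- `θ₁ = (ρ^{1/2} - ρ^{(τ+1)/2}) / (1 - ρ^{1/2})`. -/
def theta1 (ρ : ℝ) (τ : ℕ) : ℝ :=
  (ρ ^ ((1 : ℝ) / 2) - ρ ^ (((τ : ℝ) + 1) / 2)) / (1 - ρ ^ ((1 : ℝ) / 2))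

/-- `θ₂ = (ρ^{1/2} - ρ^{m/2}) / (1 - ρ^{1/2})`. -/
def theta2 (ρ : ℝ) (m : ℕ) : ℝ :=
  (ρ ^ ((1 : ℝ) / 2) - ρ ^ ((m : ℝ) / 2)) / (1 - ρ ^ ((1 : ℝ) / 2))

/-- `θ' = (ρ^{τ+1} - ρ) / (ρ - 1)`. -/
def theta' (ρ : ℝ) (τ : ℕ) : ℝ := (ρ ^ (τ + 1) - ρ) / (ρ - 1)

end AsySBCDVR

end

/-!
The proof is a Lyapunov argument for `‖x - π x‖² + 2 c F(x)`, where `c = γ / Lmax` and `π` is the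
projection onto the solution set.

Let `U` be the proximal gradient step that iteration `t` would make in *all* blocks with its
mini-batch (`IsInnerLoop.full`). The step actually made is one uniformly random block of `U`, so
its expected squared length is `E‖U‖² / k` (`IsInnerLoop.integral_move_sq`). Summed over the blocks,
the variational inequality of the proximal points gives `integral_dist_sq_sub_le` for the distance
to the solutions, and the smoothness of `f` gives `integral_FReal_sub_le` for the objective.
Together they yield progress proportional to the optimality gap, up to three errors, each of which
is absorbed by the term `-E‖U‖²`: the quadratic term of the smooth model, the delay of the read
(`integral_inner_vhat_le`), and the gap between the gradient and the direction used
(`integral_inner_grad_sub_vhat_le`). In the last one the mini-batch noise enters only through its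
second moment, which centering can only decrease (`integral_noise_sq_le`).

The errors are made of steps of *earlier* iterations, so they have to be compared with the current
`U`. This is `growth_of_step_le`: consecutive full steps differ little, because proximal maps are
nonexpansive and the directions are Lipschitz in the iterates, so that `E‖U‖²` shrinks by at most
the factor `ρ` per iteration under the first step size condition. The second condition then says
exactly that the errors are absorbed (`one_step`, `inner_loop`), and the two rates follow from the
recursion over outer loops (`linear_rate`, `sublinear_rate`).

All random variables of a run take finitely many values, since a read masks earlier updates in one
of finitely many ways; hence integrability is never an issue. Proximal points are known to exist
only for the blocks that are drawn, but every block is drawn with positive probability given the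
past, so almost surely they exist for all blocks (`ae_forall_draw`).
-/

noncomputable section

namespace AsySBCDVR

open scoped InnerProductSpace

/-! ### Blocks of coordinates -/

namespace Problem

variable {n k N : ℕ} (P : Problem n k N)

/-- The vector that agrees with `d` on the block `j` and vanishes elsewhere. -/
def blk (j : Fin k) (d : Vec n) : Vec n :=
  WithLp.toLp 2 (fun c => if P.block c = j then d c else 0)

@[simp] lemma blk_apply (j : Fin k) (d : Vec n) (c : Fin n) :
    P.blk j d c = if P.block c = j then d c else 0 := rfl

@[simp] lemma part_apply (j : Fin k) (d : Vec n) (c : {c : Fin n // P.block c = j}) :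
    P.part j d c = d c.1 := rfl

lemma part_add (j : Fin k) (a b : Vec n) : P.part j (a + b) = P.part j a + P.part j b := rfl

lemma part_sub (j : Fin k) (a b : Vec n) : P.part j (a - b) = P.part j a - P.part j b := rfl

lemma part_smul (j : Fin k) (r : ℝ) (a : Vec n) : P.part j (r • a) = r • P.part j a := rfl

lemma continuous_part (j : Fin k) : Continuous (P.part j) := by
  unfold part
  fun_prop

lemma supportedOn_blk (j : Fin k) (d : Vec n) : P.SupportedOn j (P.blk j d) := by
  intro c hc
  simp [hc]

lemma part_blk_self (j : Fin k) (d : Vec n) : P.part j (P.blk j d) = P.part j d := by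
  ext c
  simp [c.2]

lemma part_blk_of_ne {j j' : Fin k} (h : j' ≠ j) (d : Vec n) : P.part j' (P.blk j d) = 0 := by
  ext c
  simp [c.2, h]

lemma sum_blk (d : Vec n) : ∑ j, P.blk j d = d := by
  ext c
  simp

lemma sum_fiber (h : Fin n → ℝ) :
    ∑ j, ∑ c : {c : Fin n // P.block c = j}, h c.1 = ∑ c, h c := by
  rw [← Fintype.sum_sigma']
  exact Fintype.sum_equiv (Equiv.sigmaFiberEquiv P.block) _ _ (fun _ => rfl)

lemma sum_inner_part (a b : Vec n) : ∑ j, ⟪P.part j a, P.part j b⟫_ℝ = ⟪a, b⟫_ℝ := by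
  simp only [PiLp.inner_apply, part_apply]
  exact P.sum_fiber (fun c => ⟪a c, b c⟫_ℝ)

lemma sum_norm_part_sq (a : Vec n) : ∑ j, ‖P.part j a‖ ^ 2 = ‖a‖ ^ 2 := by
  simp only [← real_inner_self_eq_norm_sq]
  exact P.sum_inner_part a a

lemma part_eq_zero_of_supportedOn {j j' : Fin k} {d : Vec n} (hd : P.SupportedOn j d)
    (h : j' ≠ j) : P.part j' d = 0 := by
  ext c
  exact hd c.1 (by rw [c.2]; exact h)

lemma inner_of_supportedOn {j : Fin k} {d : Vec n} (hd : P.SupportedOn j d) (a : Vec n) :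
    ⟪a, d⟫_ℝ = ⟪P.part j a, P.part j d⟫_ℝ := by
  rw [← P.sum_inner_part, Finset.sum_eq_single j]
  · intro j' _ h
    rw [P.part_eq_zero_of_supportedOn hd h, inner_zero_right]
  · simp

lemma norm_part_of_supportedOn {j : Fin k} {d : Vec n} (hd : P.SupportedOn j d) :
    ‖P.part j d‖ = ‖d‖ := by
  have h := P.inner_of_supportedOn hd d
  rw [real_inner_self_eq_norm_sq, real_inner_self_eq_norm_sq] at h
  exact ((sq_eq_sq₀ (norm_nonneg _) (norm_nonneg _)).1 h).symm

lemma norm_blk (j : Fin k) (d : Vec n) : ‖P.blk j d‖ = ‖P.part j d‖ := by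
  rw [← P.norm_part_of_supportedOn (P.supportedOn_blk j d), part_blk_self]

lemma sum_norm_blk_sq (d : Vec n) : ∑ j, ‖P.blk j d‖ ^ 2 = ‖d‖ ^ 2 := by
  simp only [norm_blk, sum_norm_part_sq]

lemma ext_part {a b : Vec n} (h : ∀ j, P.part j a = P.part j b) : a = b := by
  ext c
  have := congrArg (fun z => z ⟨c, rfl⟩) (h (P.block c))
  simpa using this

/-- The vector with prescribed blocks. -/
def glue (z : (j : Fin k) → EuclideanSpace ℝ {c : Fin n // P.block c = j}) : Vec n :=
  WithLp.toLp 2 (fun c => z (P.block c) ⟨c, rfl⟩)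

lemma part_glue (z : (j : Fin k) → EuclideanSpace ℝ {c : Fin n // P.block c = j}) (j : Fin k) :
    P.part j (P.glue z) = z j := by
  ext ⟨c, hc⟩
  subst hc
  rfl

/-- Averaged over the blocks, a step along one block moves the squared distance to `p` by `1 / k`
times what the full step `d` contributes. -/
lemma sum_norm_add_blk_sub_sq (x d p : Vec n) :
    ∑ j, (‖x + P.blk j d - p‖ ^ 2 - ‖x - p‖ ^ 2) = ‖d‖ ^ 2 + 2 * ⟪d, x - p⟫_ℝ := by
  have h : ∀ j, ‖x + P.blk j d - p‖ ^ 2 - ‖x - p‖ ^ 2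
      = ‖P.blk j d‖ ^ 2 + 2 * ⟪P.blk j d, x - p⟫_ℝ := by
    intro j
    rw [show x + P.blk j d - p = P.blk j d + (x - p) by abel, norm_add_sq_real]
    ring
  simp only [h, Finset.sum_add_distrib, ← Finset.mul_sum, sum_norm_blk_sq, ← sum_inner, sum_blk]

end Problem

/-! ### Proximal points -/

section Prox

lemma IsProx.ne_top {V : Type*} [NormedAddCommGroup V] {c : ℝ} {h : V → EReal} {u z w : V}
    (hz : IsProx c h u z) (hc : 0 < c) (hbot : ∀ w, h w ≠ ⊥) (hw : h w ≠ ⊤) : h z ≠ ⊤ := by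
  intro htop
  have h1 := hz w
  lift h w to ℝ using ⟨hw, hbot w⟩ with r hr
  rw [htop, EReal.coe_mul_top_of_pos hc, EReal.top_add_coe, top_le_iff] at h1
  norm_cast at h1
  exact EReal.coe_ne_top _ h1

variable {V : Type*} [NormedAddCommGroup V] [InnerProductSpace ℝ V]
  {c : ℝ} {h : V → EReal} {u z w : V}

/-- The subgradient inequality at a proximal point: `(u - z) / c` is a subgradient of `h`
at `z`. -/
lemma IsProx.variational (hz : IsProx c h u z) (hc : 0 < c) (hbot : ∀ w, h w ≠ ⊥)
    (hconv : Convex ℝ {p : V × ℝ | h p.1 ≤ p.2}) (hw : h w ≠ ⊤) :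
    c * (h z).toReal + ⟪u - z, w - z⟫_ℝ ≤ c * (h w).toReal := by
  have hzt := hz.ne_top hc hbot hw
  -- Compare `z` with the points `z + a (w - z)` and let `a` tend to `0`.
  have key : ∀ a : ℝ, 0 < a → a ≤ 1 →
      c * (h z).toReal + ⟪u - z, w - z⟫_ℝ ≤ c * (h w).toReal + a / 2 * ‖w - z‖ ^ 2 := by
    intro a ha ha1
    have hmem : (1 - a) • ((z, (h z).toReal) : V × ℝ) + a • ((w, (h w).toReal) : V × ℝ) ∈
        {p : V × ℝ | h p.1 ≤ p.2} := by
      apply hconv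
      · simp [EReal.coe_toReal hzt (hbot z)]
      · simp [EReal.coe_toReal hw (hbot w)]
      · linarith
      · exact ha.le
      · ring
    simp only [Set.mem_ofPred_eq, Prod.fst_add, Prod.smul_fst, Prod.snd_add, Prod.smul_snd,
      smul_eq_mul] at hmem
    have hy := hz ((1 - a) • z + a • w)
    set y := (1 - a) • z + a • w with hydef
    have hyt : h y ≠ ⊤ := fun e => by rw [e, top_le_iff] at hmem; exact EReal.coe_ne_top _ hmem
    have hzr := EReal.coe_toReal hzt (hbot z)
    have hyr := EReal.coe_toReal hyt (hbot y)
    rw [← hzr, ← hyr] at hy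
    rw [← hyr] at hmem
    norm_cast at hy hmem
    have hsq : ‖y - u‖ ^ 2 = ‖z - u‖ ^ 2 - 2 * a * ⟪u - z, w - z⟫_ℝ + a ^ 2 * ‖w - z‖ ^ 2 := by
      have : y - u = (z - u) + a • (w - z) := by
        rw [hydef]; module
      rw [this, norm_add_sq_real, inner_smul_right, norm_smul, mul_pow, Real.norm_eq_abs, sq_abs,
        ← neg_sub u z, inner_neg_left]
      ring
    have hcm := mul_le_mul_of_nonneg_left hmem hc.le
    have : a * (c * (h z).toReal + ⟪u - z, w - z⟫_ℝ) ≤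
        a * (c * (h w).toReal + a / 2 * ‖w - z‖ ^ 2) := by
      rw [hsq] at hy
      nlinarith
    exact le_of_mul_le_mul_left this ha
  refine le_of_forall_pos_le_add fun ε hε => ?_
  have hpos : 0 < ‖w - z‖ ^ 2 + 1 := by positivity
  refine (key (min 1 (ε / (‖w - z‖ ^ 2 + 1))) (by positivity) (min_le_left _ _)).trans ?_
  have h1 : min 1 (ε / (‖w - z‖ ^ 2 + 1)) * (‖w - z‖ ^ 2 + 1) ≤ ε :=
    (le_div_iff₀ hpos).1 (min_le_right _ _)
  have h2 : 0 < min 1 (ε / (‖w - z‖ ^ 2 + 1)) := by positivity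
  nlinarith [sq_nonneg ‖w - z‖]

lemma IsProx.unique {z' : V} (hz : IsProx c h u z) (hz' : IsProx c h u z') (hc : 0 < c)
    (hbot : ∀ w, h w ≠ ⊥) (hconv : Convex ℝ {p : V × ℝ | h p.1 ≤ p.2}) (hw : h w ≠ ⊤) :
    z = z' := by
  have h1 := hz.variational hc hbot hconv (hz'.ne_top hc hbot hw)
  have h2 := hz'.variational hc hbot hconv (hz.ne_top hc hbot hw)
  have h3 : ⟪u - z, z' - z⟫_ℝ + ⟪u - z', z - z'⟫_ℝ = ‖z - z'‖ ^ 2 := by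
    rw [← real_inner_self_eq_norm_sq, ← neg_sub z z', inner_neg_right, neg_add_eq_sub,
      ← inner_sub_left]
    congr 1
    abel
  have h4 : ‖z - z'‖ ^ 2 ≤ 0 := by linarith
  exact sub_eq_zero.1 (norm_eq_zero.1 (by nlinarith [norm_nonneg (z - z')]))

end Prox

namespace Problem

variable {n k N : ℕ} (P : Problem n k N)

/-- `x` lies in the domain of `g`. -/
def Dom (x : Vec n) : Prop := ∀ j, P.g j (P.part j x) ≠ ⊤

/-- The real value of `g`, meaningful on `P.Dom`. -/
def gReal (x : Vec n) : ℝ := ∑ j, (P.g j (P.part j x)).toReal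

/-- Every block of the proximal gradient step from `x` along `-v` with step size `c` exists. -/
def ProxSolvable (c : ℝ) (x v : Vec n) : Prop :=
  ∀ j, ∃ z, IsProx c (P.g j) (P.part j x - c • P.part j v) z

/-- The displacement of the proximal gradient step from `x` along `-v`, taken in all blocks at
once. A block whose proximal point does not exist gets an arbitrary value. -/
def fullStep (c : ℝ) (x v : Vec n) : Vec n :=
  P.glue (fun j => Classical.epsilon fun z => IsProx c (P.g j) (P.part j x - c • P.part j v) z) - x

variable {P} {c : ℝ} {x x' v v' w : Vec n}

lemma isProx_fullStep {j : Fin k} (h : ∃ z, IsProx c (P.g j) (P.part j x - c • P.part j v) z) :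
    IsProx c (P.g j) (P.part j x - c • P.part j v) (P.part j (x + P.fullStep c x v)) := by
  have : x + P.fullStep c x v = P.glue (fun j => Classical.epsilon fun z =>
      IsProx c (P.g j) (P.part j x - c • P.part j v) z) := by
    simp [fullStep]
  rw [this, part_glue]
  exact Classical.epsilon_spec h

lemma dom_add_fullStep (hc : 0 < c) (hx : P.ProxSolvable c x v) (hw : P.Dom w) :
    P.Dom (x + P.fullStep c x v) :=
  fun j => (isProx_fullStep (hx j)).ne_top hc (P.g_ne_bot j) (hw j)

lemma fullStep_variational (hc : 0 < c) (hx : P.ProxSolvable c x v) (hw : P.Dom w) :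
    c * P.gReal (x + P.fullStep c x v)
      - ⟪P.fullStep c x v + c • v, w - x - P.fullStep c x v⟫_ℝ ≤ c * P.gReal w := by
  have h : ∀ j, c * (P.g j (P.part j (x + P.fullStep c x v))).toReal -
      ⟪P.part j (P.fullStep c x v + c • v), P.part j (w - x - P.fullStep c x v)⟫_ℝ ≤
      c * (P.g j (P.part j w)).toReal := by
    intro j
    have h1 := (isProx_fullStep (hx j)).variational hc (P.g_ne_bot j) (P.g_convex j) (hw j)
    have h2 : P.part j x - c • P.part j v - P.part j (x + P.fullStep c x v)
        = - P.part j (P.fullStep c x v + c • v) := by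
      simp only [part_add, part_smul]
      abel
    have h3 : P.part j w - P.part j (x + P.fullStep c x v)
        = P.part j (w - x - P.fullStep c x v) := by
      simp only [part_add, part_sub]
      abel
    rw [h2, h3, inner_neg_left] at h1
    linarith
  have := Finset.sum_le_sum fun j (_ : j ∈ Finset.univ) => h j
  rwa [Finset.sum_sub_distrib, sum_inner_part, ← Finset.mul_sum, ← Finset.mul_sum] at this

/-- The proximal gradient displacement is Lipschitz in the point and in the direction, because
proximal maps are nonexpansive. -/
lemma norm_fullStep_sub_le (hc : 0 < c) (hx : P.ProxSolvable c x v)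
    (hx' : P.ProxSolvable c x' v') (hw : P.Dom w) :
    ‖P.fullStep c x v - P.fullStep c x' v'‖ ≤ 2 * ‖x - x'‖ + c * ‖v - v'‖ := by
  have h1 := fullStep_variational hc hx (dom_add_fullStep hc hx' hw)
  have h2 := fullStep_variational hc hx' (dom_add_fullStep hc hx hw)
  set d := P.fullStep c x v
  set d' := P.fullStep c x' v'
  set e := (x + d) - (x' + d') with he
  have h3 : ⟪d + c • v, x' + d' - x - d⟫_ℝ + ⟪d' + c • v', x + d - x' - d'⟫_ℝ
      = ⟪(x - x') - c • (v - v'), e⟫_ℝ - ‖e‖ ^ 2 := by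
    rw [← real_inner_self_eq_norm_sq, show x' + d' - x - d = -e by rw [he]; abel,
      show x + d - x' - d' = e by rw [he]; abel, inner_neg_right, neg_add_eq_sub,
      ← inner_sub_left, ← inner_sub_left]
    congr 1
    rw [he, smul_sub]
    abel
  have h4 : ‖e‖ ^ 2 ≤ ⟪(x - x') - c • (v - v'), e⟫_ℝ := by linarith
  have h5 : ‖(x - x') - c • (v - v')‖ ≤ ‖x - x'‖ + c * ‖v - v'‖ := by
    refine (norm_sub_le _ _).trans ?_
    rw [norm_smul, Real.norm_of_nonneg hc.le]
  have h6 : ‖e‖ ≤ ‖x - x'‖ + c * ‖v - v'‖ := by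
    rcases (norm_nonneg e).eq_or_lt with h0 | h0
    · rw [← h0]; positivity
    · refine le_of_mul_le_mul_right ?_ h0
      calc ‖e‖ * ‖e‖ = ‖e‖ ^ 2 := by ring
        _ ≤ _ := h4
        _ ≤ _ := real_inner_le_norm _ _
        _ ≤ _ := mul_le_mul_of_nonneg_right h5 h0.le
  calc ‖d - d'‖ = ‖e - (x - x')‖ := by rw [he]; congr 1; abel
    _ ≤ ‖e‖ + ‖x - x'‖ := norm_sub_le _ _
    _ ≤ _ := by linarith

lemma norm_fullStep_sq_le (hc : 0 < c) (hx : P.ProxSolvable c x v) (hd : P.Dom x) :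
    ‖P.fullStep c x v‖ ^ 2 ≤
      c * (P.gReal x - P.gReal (x + P.fullStep c x v) - ⟪v, P.fullStep c x v⟫_ℝ) := by
  have h := fullStep_variational hc hx hd
  rw [sub_self, zero_sub, inner_neg_right, inner_add_left, real_inner_self_eq_norm_sq,
    real_inner_smul_left] at h
  linarith

lemma sum_norm_add_blk_fullStep_le (hc : 0 < c) (hx : P.ProxSolvable c x v) {p : Vec n}
    (hp : P.Dom p) :
    ∑ j, (‖x + P.blk j (P.fullStep c x v) - p‖ ^ 2 - ‖x - p‖ ^ 2) ≤
      - ‖P.fullStep c x v‖ ^ 2 + 2 * c * (⟪v, p - x⟫_ℝ - ⟪v, P.fullStep c x v⟫_ℝ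
        + P.gReal p - P.gReal (x + P.fullStep c x v)) := by
  have h := fullStep_variational hc hx hp
  rw [sum_norm_add_blk_sub_sq]
  set d := P.fullStep c x v
  have h1 : ⟪d + c • v, p - x - d⟫_ℝ
      = - ⟪d, x - p⟫_ℝ - ‖d‖ ^ 2 + c * (⟪v, p - x⟫_ℝ - ⟪v, d⟫_ℝ) := by
    rw [inner_add_left, real_inner_smul_left, inner_sub_right, inner_sub_right v,
      real_inner_self_eq_norm_sq, ← neg_sub x p, inner_neg_right]
  rw [h1] at h
  linarith

lemma part_add_blk_self (j : Fin k) (x d : Vec n) :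
    P.part j (x + P.blk j d) = P.part j (x + d) := by
  rw [part_add, part_blk_self, part_add]

lemma part_add_blk_of_ne {j j' : Fin k} (h : j' ≠ j) (x d : Vec n) :
    P.part j' (x + P.blk j d) = P.part j' x := by
  rw [part_add, part_blk_of_ne P h, add_zero]

lemma sum_gReal_add_blk_sub (x d : Vec n) :
    ∑ j, (P.gReal (x + P.blk j d) - P.gReal x) = P.gReal (x + d) - P.gReal x := by
  have h : ∀ j, P.gReal (x + P.blk j d) - P.gReal x
      = (P.g j (P.part j (x + d))).toReal - (P.g j (P.part j x)).toReal := by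
    intro j
    unfold gReal
    rw [← Finset.sum_sub_distrib, Finset.sum_eq_single j]
    · rw [part_add_blk_self]
    · intro j' _ hj
      rw [part_add_blk_of_ne hj, sub_self]
    · simp
  simp only [h, Finset.sum_sub_distrib]
  rfl

end Problem

/-! ### Smooth and convex functions -/

section Smooth

variable {V : Type*} [NormedAddCommGroup V] [InnerProductSpace ℝ V] [CompleteSpace V]
  {f : V → ℝ} {G : V → V}

lemma hasDerivAt_comp_line (hG : ∀ x, HasGradientAt f (G x) x) (x d : V) (r : ℝ) :
    HasDerivAt (fun r : ℝ => f (x + r • d)) ⟪G (x + r • d), d⟫_ℝ r := by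
  have h1 : HasDerivAt (fun r : ℝ => x + r • d) d r := by
    simpa using ((hasDerivAt_id r).smul_const d).const_add x
  have h2 := (hG (x + r • d)).hasFDerivAt.comp_hasDerivAt r h1
  rw [InnerProductSpace.toDual_apply_apply] at h2
  exact h2

/-- The quadratic upper bound for a gradient that is Lipschitz along the segment from `x`
to `x + d`. -/
lemma le_add_inner_add_sq (hG : ∀ x, HasGradientAt f (G x) x) {x d : V} {L : ℝ}
    (hL : ∀ r : ℝ, 0 ≤ r → ⟪G (x + r • d) - G x, d⟫_ℝ ≤ r * L * ‖d‖ ^ 2) :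
    f (x + d) ≤ f x + ⟪G x, d⟫_ℝ + L / 2 * ‖d‖ ^ 2 := by
  let φ : ℝ → ℝ := fun r => f (x + r • d) - r * ⟪G x, d⟫_ℝ - L / 2 * ‖d‖ ^ 2 * r ^ 2
  have hφ : ∀ r, HasDerivAt φ
      (⟪G (x + r • d), d⟫_ℝ - 1 * ⟪G x, d⟫_ℝ - L / 2 * ‖d‖ ^ 2 * (2 * r)) r := by
    intro r
    have h2 : HasDerivAt (fun r : ℝ => r ^ 2) (2 * r) r := by simpa using hasDerivAt_pow 2 r
    exact ((hasDerivAt_comp_line hG x d r).sub ((hasDerivAt_id r).mul_const _)).sub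
      (h2.const_mul _)
  have hanti : AntitoneOn φ (Set.Icc 0 1) := by
    refine antitoneOn_of_deriv_nonpos (convex_Icc 0 1)
      (fun r _ => (hφ r).continuousAt.continuousWithinAt)
      (fun r _ => (hφ r).differentiableAt.differentiableWithinAt) fun r hr => ?_
    rw [interior_Icc] at hr
    rw [(hφ r).deriv]
    have := hL r hr.1.le
    rw [inner_sub_left] at this
    linarith
  have h := hanti (Set.left_mem_Icc.2 zero_le_one) (Set.right_mem_Icc.2 zero_le_one) zero_le_one
  simp only [φ, one_smul, zero_smul, add_zero] at h
  linarith

lemma ConvexOn.add_inner_le (hf : ConvexOn ℝ Set.univ f) (hG : ∀ x, HasGradientAt f (G x) x)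
    (x y : V) : f x + ⟪G x, y - x⟫_ℝ ≤ f y := by
  have hc : ConvexOn ℝ Set.univ (fun r : ℝ => f (x + r • (y - x))) := by
    refine ⟨convex_univ, fun a _ b _ p q hp hq hpq => ?_⟩
    have h := hf.2 (Set.mem_univ (x + a • (y - x))) (Set.mem_univ (x + b • (y - x))) hp hq hpq
    convert h using 2
    simp only [smul_eq_mul, smul_add, smul_smul]
    rw [add_add_add_comm, ← add_smul p q x, hpq, one_smul, ← add_smul]
  have h0 := hasDerivAt_comp_line hG x (y - x) 0
  have h := hc.le_slope_of_hasDerivAt (Set.mem_univ 0) (Set.mem_univ 1) zero_lt_one h0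
  simp [slope_def_field] at h
  linarith

end Smooth

/-! ### Mini-batch averages -/

section Average

variable {ι V : Type*} [NormedAddCommGroup V] [InnerProductSpace ℝ V]

lemma norm_average_le {A : Finset ι} (hA : A.Nonempty) {y : ι → V} {C : ℝ}
    (hy : ∀ i, ‖y i‖ ≤ C) : ‖(A.card : ℝ)⁻¹ • ∑ i ∈ A, y i‖ ≤ C := by
  have hpos : (0 : ℝ) < A.card := by exact_mod_cast hA.card_pos
  rw [norm_smul, norm_inv, Real.norm_natCast, inv_mul_le_iff₀ hpos]
  calc ‖∑ i ∈ A, y i‖ ≤ ∑ i ∈ A, C := norm_sum_le_of_le _ fun i _ => hy i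
    _ = A.card * C := by rw [Finset.sum_const, nsmul_eq_mul]

/-- The second moment around the mean is at most the second moment around `0`. -/
lemma sum_norm_sub_mean_sq_le {S : Finset ι} {y : ι → V} {m : V}
    (hm : ∑ i ∈ S, y i = (S.card : ℝ) • m) :
    ∑ i ∈ S, ‖y i - m‖ ^ 2 ≤ ∑ i ∈ S, ‖y i‖ ^ 2 := by
  simp only [norm_sub_sq_real, Finset.sum_add_distrib, Finset.sum_sub_distrib, ← Finset.mul_sum,
    ← sum_inner, hm, real_inner_smul_left, real_inner_self_eq_norm_sq, Finset.sum_const,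
    nsmul_eq_mul]
  have : (0 : ℝ) ≤ S.card * ‖m‖ ^ 2 := by positivity
  linarith

/-- The mean over a uniformly random mini-batch is unbiased. -/
lemma sum_powersetCard_average [Fintype ι] [DecidableEq ι] {b : ℕ} (hb : 1 ≤ b)
    (hbN : b ≤ Fintype.card ι) (y : ι → V) :
    ∑ A ∈ Finset.powersetCard b Finset.univ, (A.card : ℝ)⁻¹ • ∑ i ∈ A, y i =
      ((Fintype.card ι).choose b : ℝ) • ((Fintype.card ι : ℝ)⁻¹ • ∑ i, y i) := by
  have h1 : ∑ A ∈ Finset.powersetCard b (Finset.univ : Finset ι), (A.card : ℝ)⁻¹ • ∑ i ∈ A, y i =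
      (b : ℝ)⁻¹ • ∑ A ∈ Finset.powersetCard b (Finset.univ : Finset ι), ∑ i ∈ A, y i := by
    rw [Finset.smul_sum]
    refine Finset.sum_congr rfl fun A hA => ?_
    rw [(Finset.mem_powersetCard.1 hA).2]
  have h2 : ∑ A ∈ Finset.powersetCard b (Finset.univ : Finset ι), ∑ i ∈ A, y i =
      ∑ i, ∑ A ∈ Finset.powersetCard b (Finset.univ : Finset ι) with {i} ⊆ A, y i := by
    refine Finset.sum_comm' fun A i => ?_
    simp
  have h3 : ∀ i : ι, (Finset.powersetCard b (Finset.univ : Finset ι) |>.filter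
      ({i} ⊆ ·)).card = (Fintype.card ι - 1).choose (b - 1) := by
    intro i
    rw [Finset.card_filter_powersetCard_subset _ _ _ (Finset.subset_univ _) (by simpa using hb)]
    simp
  simp only [h1, h2, Finset.sum_const, h3, ← Finset.smul_sum, smul_smul, ← Nat.cast_smul_eq_nsmul ℝ]
  congr 1
  obtain ⟨b, rfl⟩ : ∃ a, b = a + 1 := ⟨b - 1, by omega⟩
  obtain ⟨M, hM⟩ : ∃ M, Fintype.card ι = M + 1 := ⟨Fintype.card ι - 1, by omega⟩
  rw [hM, Nat.add_sub_cancel, Nat.add_sub_cancel]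
  have h4 : ((M + 1 : ℕ) : ℝ) * (M.choose b : ℝ) = ((M + 1).choose (b + 1) : ℝ) * (b + 1 : ℕ) := by
    exact_mod_cast Nat.add_one_mul_choose_eq M b
  have h5 : ((M + 1 : ℕ) : ℝ) ≠ 0 := by positivity
  have h6 : ((b + 1 : ℕ) : ℝ) ≠ 0 := by positivity
  field_simp
  linarith

end Average

/-! ### Gradients of the components -/

namespace Problem

variable {n k N : ℕ} (P : Problem n k N)

/-- The smooth part `f` of the objective. -/
def fReal (x : Vec n) : ℝ := (N : ℝ)⁻¹ * ∑ i, P.f i x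

/-- The average of the gradients of the components in `A`. -/
def gradAvg (A : Finset (Fin N)) (x : Vec n) : Vec n :=
  (A.card : ℝ)⁻¹ • ∑ i ∈ A, gradient (P.f i) x

lemma fullGrad_eq (x : Vec n) : P.fullGrad x = P.gradAvg Finset.univ x := by
  simp [fullGrad, gradAvg]

lemma vhat_eq (A : Finset (Fin N)) (xh xt : Vec n) :
    P.vhat A xh xt = P.gradAvg A xh - P.gradAvg A xt + P.fullGrad xt := rfl

lemma gradAvg_sub (A : Finset (Fin N)) (x y : Vec n) : P.gradAvg A x - P.gradAvg A y =
    (A.card : ℝ)⁻¹ • ∑ i ∈ A, (gradient (P.f i) x - gradient (P.f i) y) := by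
  rw [gradAvg, gradAvg, ← smul_sub, Finset.sum_sub_distrib]

lemma part_sum {ι : Type*} (j : Fin k) (A : Finset ι) (y : ι → Vec n) :
    P.part j (∑ i ∈ A, y i) = ∑ i ∈ A, P.part j (y i) := by
  ext c
  simp

lemma hasGradientAt_fReal (x : Vec n) : HasGradientAt P.fReal (P.fullGrad x) x := by
  rw [hasGradientAt_iff_hasFDerivAt]
  have h : HasFDerivAt (fun x => ∑ i, P.f i x)
      (∑ i, InnerProductSpace.toDual ℝ (Vec n) (gradient (P.f i) x)) x :=
    HasFDerivAt.fun_sum fun i _ => ((P.f_differentiable i) x).hasGradientAt.hasFDerivAt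
  have h2 := h.const_smul (N : ℝ)⁻¹
  rw [fullGrad, map_smul, map_sum]
  exact h2

lemma convexOn_fReal : ConvexOn ℝ Set.univ P.fReal := by
  have h : ConvexOn ℝ Set.univ (∑ i, P.f i) :=
    Finset.sum_induction _ (ConvexOn ℝ Set.univ) (fun _ _ h1 h2 => h1.add h2)
      (convexOn_const 0 convex_univ) (fun i _ => P.f_convex i)
  have h2 := h.smul (c := (N : ℝ)⁻¹) (by positivity)
  have h3 : P.fReal = fun x => (N : ℝ)⁻¹ • (∑ i, P.f i) x := by
    ext x
    simp [fReal]
  rw [h3]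
  exact h2

variable {P}

lemma norm_gradAvg_sub_le {A : Finset (Fin N)} (hA : A.Nonempty) {x y : Vec n} {C : ℝ}
    (h : ∀ i, ‖gradient (P.f i) x - gradient (P.f i) y‖ ≤ C) :
    ‖P.gradAvg A x - P.gradAvg A y‖ ≤ C := by
  rw [gradAvg_sub]
  exact norm_average_le hA h

lemma NormalLipschitz.gradAvg {Lnor : ℝ} (hnor : P.NormalLipschitz Lnor) {A : Finset (Fin N)}
    (hA : A.Nonempty) (x y : Vec n) :
    ‖P.gradAvg A x - P.gradAvg A y‖ ≤ Lnor * ‖x - y‖ :=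
  norm_gradAvg_sub_le hA fun i => hnor i x y

lemma NormalLipschitz.fReal_add_le {Lnor : ℝ} (hnor : P.NormalLipschitz Lnor) [NeZero N]
    (x d : Vec n) :
    P.fReal (x + d) ≤ P.fReal x + ⟪P.fullGrad x, d⟫_ℝ + Lnor / 2 * ‖d‖ ^ 2 := by
  refine le_add_inner_add_sq P.hasGradientAt_fReal fun r hr => ?_
  have h := hnor.gradAvg (A := Finset.univ) Finset.univ_nonempty (x + r • d) x
  rw [add_sub_cancel_left, norm_smul, Real.norm_of_nonneg hr, ← fullGrad_eq, ← fullGrad_eq] at h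
  refine (real_inner_le_norm _ _).trans ?_
  nlinarith [mul_le_mul_of_nonneg_right h (norm_nonneg d)]

/-! ### Gradients along a sum of block updates -/

section Delay

variable {ι : Type*} [DecidableEq ι] {D : ι → Vec n} {J : ι → Fin k}

lemma BlockRestrictedLipschitz.norm_sub_le_sum {L : ℝ} (hL : P.BlockRestrictedLipschitz L)
    (hD : ∀ i, P.SupportedOn (J i) (D i)) (i : Fin N) (x : Vec n) (K : Finset ι) :
    ‖gradient (P.f i) (x + ∑ a ∈ K, D a) - gradient (P.f i) x‖ ≤ L * ∑ a ∈ K, ‖D a‖ := by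
  induction K using Finset.induction_on with
  | empty => simp
  | insert a K ha ih =>
    rw [Finset.sum_insert ha, Finset.sum_insert ha, add_comm (D a), ← add_assoc, mul_add]
    have h := hL i (J a) (x + ∑ a ∈ K, D a) (D a) (hD a)
    rw [P.norm_part_of_supportedOn (hD a)] at h
    exact (norm_sub_le_norm_sub_add_norm_sub _ _ _).trans (add_le_add h ih)

lemma BlockCoordinateLipschitz.norm_part_sub_le_sum {L : ℝ} (hL : P.BlockCoordinateLipschitz L)
    (hD : ∀ i, P.SupportedOn (J i) (D i)) (i : Fin N) (j : Fin k) (x : Vec n) (K : Finset ι) :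
    ‖P.part j (gradient (P.f i) (x + ∑ a ∈ K, D a) - gradient (P.f i) x)‖ ≤
      L * ∑ a ∈ K, ‖D a‖ := by
  induction K using Finset.induction_on with
  | empty =>
    rw [Finset.sum_empty, add_zero, sub_self, Finset.sum_empty, mul_zero]
    exact norm_le_zero_iff.2 rfl
  | insert a K ha ih =>
    rw [Finset.sum_insert ha, Finset.sum_insert ha, add_comm (D a), ← add_assoc, mul_add]
    have h := hL i (J a) (x + ∑ a ∈ K, D a) (D a) (hD a) j
    rw [P.norm_part_of_supportedOn (hD a)] at h
    simp only [part_sub] at h ih ⊢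
    exact (norm_sub_le_norm_sub_add_norm_sub _ _ _).trans (add_le_add h ih)

/-- The block coordinate Lipschitz constant controls the error of the linear model of `f` along
a sum of block updates: the cross terms only involve one block of the gradient. -/
lemma BlockCoordinateLipschitz.fReal_add_sum_le {L : ℝ} (hL : P.BlockCoordinateLipschitz L)
    [NeZero N] (hD : ∀ i, P.SupportedOn (J i) (D i)) (x : Vec n) (K : Finset ι) :
    P.fReal (x + ∑ a ∈ K, D a) ≤ P.fReal x + ⟪P.fullGrad x, ∑ a ∈ K, D a⟫_ℝ +
      L / 2 * (∑ a ∈ K, ‖D a‖) ^ 2 := by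
  have havg : ∀ (j : Fin k) (y z : Vec n) (C : ℝ),
      (∀ i, ‖P.part j (gradient (P.f i) y - gradient (P.f i) z)‖ ≤ C) →
      ‖P.part j (P.fullGrad y - P.fullGrad z)‖ ≤ C := by
    intro j y z C h
    rw [fullGrad_eq, fullGrad_eq, gradAvg_sub, part_smul, part_sum]
    exact norm_average_le Finset.univ_nonempty h
  induction K using Finset.induction_on with
  | empty => simp
  | insert a K ha ih =>
    rw [Finset.sum_insert ha, Finset.sum_insert ha, add_comm (D a), ← add_assoc,
      add_comm ‖D a‖, inner_add_right]
    set y := x + ∑ a ∈ K, D a with hy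
    have h1 : P.fReal (y + D a) ≤ P.fReal y + ⟪P.fullGrad y, D a⟫_ℝ + L / 2 * ‖D a‖ ^ 2 := by
      refine le_add_inner_add_sq P.hasGradientAt_fReal fun r hr => ?_
      have hs : P.SupportedOn (J a) (r • D a) := fun c hc => by simp [hD a c hc]
      have h := havg (J a) (y + r • D a) y _ fun i => hL i (J a) y (r • D a) hs (J a)
      rw [P.norm_part_of_supportedOn hs, norm_smul, Real.norm_of_nonneg hr] at h
      rw [P.inner_of_supportedOn (hD a)]
      refine (real_inner_le_norm _ _).trans ?_
      rw [P.norm_part_of_supportedOn (hD a)]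
      nlinarith [mul_le_mul_of_nonneg_right h (norm_nonneg (D a))]
    have h2 : ⟪P.fullGrad y, D a⟫_ℝ ≤
        ⟪P.fullGrad x, D a⟫_ℝ + L * (∑ a ∈ K, ‖D a‖) * ‖D a‖ := by
      rw [← sub_le_iff_le_add', ← inner_sub_left, P.inner_of_supportedOn (hD a)]
      refine (real_inner_le_norm _ _).trans ?_
      rw [P.norm_part_of_supportedOn (hD a)]
      exact mul_le_mul_of_nonneg_right
        (havg _ _ _ _ fun i => hL.norm_part_sub_le_sum hD i _ x K) (norm_nonneg _)
    linarith

end Delay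
end Problem

/-! ### Random variables with finitely many values -/

section FiniteValued

variable {Ω α β : Type*} {m₁ m₀ : MeasurableSpace Ω} {X : Ω → α} {Y : Ω → β}

/-- `X` takes finitely many values, each of them on a measurable set. No measurable structure on
the codomain is involved, so that every function of `X` is again of this kind. -/
structure FiniteValued (m₀ : MeasurableSpace Ω) (X : Ω → α) : Prop where
  finite_range : (Set.range X).Finite
  measurableSet_fiber : ∀ a, MeasurableSet[m₀] (X ⁻¹' {a})

namespace FiniteValued

lemma mono (hX : FiniteValued m₁ X) (h : m₁ ≤ m₀) : FiniteValued m₀ X :=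
  ⟨hX.finite_range, fun a => h _ (hX.measurableSet_fiber a)⟩

lemma measurableSet_preimage (hX : FiniteValued m₀ X) (S : Set α) :
    MeasurableSet[m₀] (X ⁻¹' S) := by
  have h : X ⁻¹' S = ⋃ a ∈ Set.range X ∩ S, X ⁻¹' {a} := by
    ext ω
    simp
  rw [h]
  exact (hX.finite_range.inter_of_left S).measurableSet_biUnion
    fun a _ => hX.measurableSet_fiber a

lemma comp (hX : FiniteValued m₀ X) (φ : α → β) : FiniteValued m₀ (fun ω => φ (X ω)) :=
  ⟨by rw [show (fun ω => φ (X ω)) = φ ∘ X from rfl, Set.range_comp]; exact hX.finite_range.image φ,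
    fun b => hX.measurableSet_preimage (φ ⁻¹' {b})⟩

lemma prodMk (hX : FiniteValued m₀ X) (hY : FiniteValued m₀ Y) :
    FiniteValued m₀ (fun ω => (X ω, Y ω)) := by
  refine ⟨(hX.finite_range.prod hY.finite_range).subset ?_, fun a => ?_⟩
  · rintro _ ⟨ω, rfl⟩
    exact ⟨⟨ω, rfl⟩, ⟨ω, rfl⟩⟩
  · have : (fun ω => (X ω, Y ω)) ⁻¹' {a} = X ⁻¹' {a.1} ∩ Y ⁻¹' {a.2} := by
      ext ω
      simp [Prod.ext_iff]
    rw [this]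
    exact (hX.measurableSet_fiber _).inter (hY.measurableSet_fiber _)

lemma integrable {μ : Measure Ω} [IsFiniteMeasure μ] {X : Ω → ℝ} (hX : FiniteValued m₀ X) :
    Integrable X μ := by
  obtain ⟨C, hC⟩ := (hX.finite_range.image fun r => ‖r‖).bddAbove
  refine Integrable.of_bound
    (Measurable.aestronglyMeasurable fun S _ => hX.measurableSet_preimage S) C ?_
  exact Filter.Eventually.of_forall fun ω => hC ⟨X ω, ⟨ω, rfl⟩, rfl⟩

end FiniteValued

end FiniteValued

/-- The Cauchy-Schwarz inequality for expectations, in terms of bounds on the second moments. -/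
lemma integral_mul_le_of_integral_sq_le {Ω : Type*} {m₀ : MeasurableSpace Ω} {μ : Measure Ω}
    [IsFiniteMeasure μ] {X Y : Ω → ℝ} (hX : FiniteValued m₀ X) (hY : FiniteValued m₀ Y)
    {a b C : ℝ} (ha : 0 ≤ a) (hb : 0 ≤ b) (hXa : ∫ ω, X ω ^ 2 ∂μ ≤ a ^ 2 * C)
    (hYb : ∫ ω, Y ω ^ 2 ∂μ ≤ b ^ 2 * C) : ∫ ω, X ω * Y ω ∂μ ≤ a * b * C := by
  have hi := (hX.prodMk hY)
  have key : ∀ p q : ℝ, 2 * (p * q) * ∫ ω, X ω * Y ω ∂μ ≤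
      p ^ 2 * ∫ ω, X ω ^ 2 ∂μ + q ^ 2 * ∫ ω, Y ω ^ 2 ∂μ := by
    intro p q
    rw [← integral_const_mul, ← integral_const_mul, ← integral_const_mul, ← integral_add
      (hX.comp fun x => p ^ 2 * x ^ 2).integrable (hY.comp fun y => q ^ 2 * y ^ 2).integrable]
    refine integral_mono (hi.comp fun z => 2 * (p * q) * (z.1 * z.2)).integrable
      (hi.comp fun z => p ^ 2 * z.1 ^ 2 + q ^ 2 * z.2 ^ 2).integrable fun ω => ?_
    simp only
    nlinarith [sq_nonneg (p * X ω - q * Y ω)]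
  -- Perturb `a` and `b` to positive numbers, where `key` with `p = b + ε`, `q = a + ε` suffices.
  have hX0 : 0 ≤ ∫ ω, X ω ^ 2 ∂μ := integral_nonneg fun ω => sq_nonneg _
  have hY0 : 0 ≤ ∫ ω, Y ω ^ 2 ∂μ := integral_nonneg fun ω => sq_nonneg _
  by_cases hC : 0 ≤ C
  · have h2 : ∀ ε : ℝ, 0 < ε → ∫ ω, X ω * Y ω ∂μ ≤ (a + ε) * (b + ε) * C := by
      intro ε hε
      have h := key (b + ε) (a + ε)
      have e1 : ∫ ω, X ω ^ 2 ∂μ ≤ (a + ε) ^ 2 * C :=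
        hXa.trans (mul_le_mul_of_nonneg_right (pow_le_pow_left₀ ha (by linarith) 2) hC)
      have e2 : ∫ ω, Y ω ^ 2 ∂μ ≤ (b + ε) ^ 2 * C :=
        hYb.trans (mul_le_mul_of_nonneg_right (pow_le_pow_left₀ hb (by linarith) 2) hC)
      have e3 := mul_le_mul_of_nonneg_left e1 (sq_nonneg (b + ε))
      have e4 := mul_le_mul_of_nonneg_left e2 (sq_nonneg (a + ε))
      have hp : 0 < 2 * ((b + ε) * (a + ε)) := by positivity
      refine le_of_mul_le_mul_left ?_ hp
      calc _ ≤ _ := h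
        _ ≤ _ := add_le_add e3 e4
        _ = _ := by ring
    have hlim : Filter.Tendsto (fun ε : ℝ => (a + ε) * (b + ε) * C) (nhdsWithin 0 (Set.Ioi 0))
        (nhds ((a + 0) * (b + 0) * C)) :=
      (Continuous.tendsto (by fun_prop) 0).mono_left nhdsWithin_le_nhds
    rw [add_zero, add_zero] at hlim
    exact ge_of_tendsto hlim (by filter_upwards [self_mem_nhdsWithin] with ε hε using h2 ε hε)
  · have ha0 : a ^ 2 = 0 := by nlinarith [sq_nonneg a]
    have hb0 : b ^ 2 = 0 := by nlinarith [sq_nonneg b]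
    have h := key 1 1
    rw [ha0, zero_mul] at hXa
    rw [hb0, zero_mul] at hYb
    rw [pow_eq_zero_iff two_ne_zero] at ha0
    rw [ha0, zero_mul, zero_mul]
    linarith

/-! ### A uniform draw that is independent of the past -/

section Draw

variable {Ω α δ : Type*} {m₁ m₀ : MeasurableSpace Ω} {μ : Measure Ω} [IsProbabilityMeasure μ]
  {X : Ω → α} {D : Ω → δ} {S : Finset δ}

/-- The expectation of a function of the past `X` and of a draw `D` that is uniform on `S` given
the past is that of the average over `S`. -/
lemma integral_draw (hm : m₁ ≤ m₀) (hX : FiniteValued m₁ X) (hD : FiniteValued m₀ D)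
    (hDS : ∀ ω, D ω ∈ S)
    (hunif : ∀ C, MeasurableSet[m₁] C → ∀ d ∈ S, μ.real (C ∩ D ⁻¹' {d}) = μ.real C / S.card)
    (φ : α → δ → ℝ) :
    ∫ ω, φ (X ω) (D ω) ∂μ = ∫ ω, (S.card : ℝ)⁻¹ * ∑ d ∈ S, φ (X ω) d ∂μ := by
  classical
  have hX0 := hX.mono hm
  have hfib : ∀ (ψ : α → ℝ) (d : δ), d ∈ S →
      ∫ ω in D ⁻¹' {d}, ψ (X ω) ∂μ = (S.card : ℝ)⁻¹ * ∫ ω, ψ (X ω) ∂μ := by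
    intro ψ d hd
    have hsum : ∀ ω, ψ (X ω) = ∑ a ∈ hX.finite_range.toFinset,
        (X ⁻¹' {a}).indicator (fun _ => ψ a) ω := by
      intro ω
      rw [Finset.sum_eq_single (X ω)]
      · simp
      · intro a _ ha
        exact Set.indicator_of_notMem (fun h => ha h.symm) _
      · intro h
        simp at h
    have hint : ∀ a, Integrable ((X ⁻¹' {a}).indicator fun _ => ψ a) μ := fun a =>
      (integrable_const _).indicator (hX0.measurableSet_fiber a)
    simp only [hsum]
    rw [integral_finsetSum _ fun a _ => (hint a).integrableOn,
      integral_finsetSum _ fun a _ => hint a, Finset.mul_sum]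
    refine Finset.sum_congr rfl fun a _ => ?_
    rw [integral_indicator (hX0.measurableSet_fiber a),
      integral_indicator (hX0.measurableSet_fiber a), setIntegral_const,
      setIntegral_const, measureReal_restrict_apply (hX0.measurableSet_fiber a),
      hunif _ (hX.measurableSet_fiber a) d hd]
    simp only [smul_eq_mul]
    ring
  have hsplit : ∀ ω, φ (X ω) (D ω) = ∑ d ∈ S, (D ⁻¹' {d}).indicator (fun ω => φ (X ω) d) ω := by
    intro ω
    rw [Finset.sum_eq_single (D ω)]
    · simp
    · intro d _ hd
      exact Set.indicator_of_notMem (fun h => hd h.symm) _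
    · exact fun h => absurd (hDS ω) h
  simp only [hsplit]
  rw [integral_finsetSum _ fun d _ =>
      ((hX0.comp fun x => φ x d).integrable).indicator (hD.measurableSet_fiber d),
    integral_const_mul, integral_finsetSum _ fun d _ => (hX0.comp fun x => φ x d).integrable,
    Finset.mul_sum]
  refine Finset.sum_congr rfl fun d hd => ?_
  rw [integral_indicator (hD.measurableSet_fiber d), hfib (fun x => φ x d) d hd]

/-- What holds for the realized draw holds almost surely for every possible draw, since each of
them has positive probability given the past. -/
lemma ae_forall_draw (hX : FiniteValued m₁ X)
    (hunif : ∀ C, MeasurableSet[m₁] C → ∀ d ∈ S, μ.real (C ∩ D ⁻¹' {d}) = μ.real C / S.card)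
    {R : α → δ → Prop} (hR : ∀ ω, R (X ω) (D ω)) : ∀ᵐ ω ∂μ, ∀ d ∈ S, R (X ω) d := by
  rw [Finset.eventually_all]
  intro d hd
  have hC := hX.measurableSet_preimage {a | ¬ R a d}
  have h := hunif _ hC d hd
  have hempty : X ⁻¹' {a | ¬ R a d} ∩ D ⁻¹' {d} = ∅ := by
    ext ω
    simp only [Set.mem_inter_iff, Set.mem_preimage, Set.mem_ofPred_eq, Set.mem_singleton_iff,
      Set.mem_empty_iff_false, iff_false, not_and]
    rintro h1 rfl
    exact h1 (hR ω)
  have hcard : (S.card : ℝ) ≠ 0 := by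
    exact_mod_cast (Finset.card_pos.2 ⟨d, hd⟩).ne'
  rw [hempty, measureReal_empty, eq_comm, div_eq_zero_iff, or_iff_left hcard,
    measureReal_eq_zero_iff] at h
  rw [ae_iff]
  exact h

end Draw

/-! ### The objective on its domain -/

namespace Problem

variable {n k N : ℕ} {P : Problem n k N}

/-- The real value of the objective `F`, meaningful on `P.Dom`. -/
def FReal (P : Problem n k N) (x : Vec n) : ℝ := P.fReal x + P.gReal x

lemma F_eq_coe {x : Vec n} (hx : P.Dom x) : P.F x = (P.FReal x : EReal) := by
  have h : ∀ S : Finset (Fin k), ∑ j ∈ S, P.g j (P.part j x) =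
      ((∑ j ∈ S, (P.g j (P.part j x)).toReal : ℝ) : EReal) := by
    intro S
    induction S using Finset.induction_on with
    | empty => simp
    | insert j S hj ih =>
      rw [Finset.sum_insert hj, Finset.sum_insert hj, EReal.coe_add, ih,
        EReal.coe_toReal (hx j) (P.g_ne_bot j _)]
  rw [F, FReal, EReal.coe_add, h, fReal, gReal]

lemma sum_g_ne_bot (S : Finset (Fin k)) (x : Vec n) : ∑ j ∈ S, P.g j (P.part j x) ≠ ⊥ := by
  refine Finset.sum_induction _ (· ≠ ⊥) (fun a b ha hb => ?_) (by simp)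
    (fun j _ => P.g_ne_bot j _)
  simp [EReal.add_eq_bot_iff, ha, hb]

lemma dom_of_F_ne_top {x : Vec n} (hx : P.F x ≠ ⊤) : P.Dom x := by
  intro j hj
  apply hx
  rw [F, ← Finset.add_sum_erase _ _ (Finset.mem_univ j), hj,
    EReal.top_add_of_ne_bot (sum_g_ne_bot _ x), EReal.add_top_of_ne_bot (EReal.coe_ne_bot _)]

lemma F_ne_bot (x : Vec n) : P.F x ≠ ⊥ := by
  rw [F, Ne, EReal.add_eq_bot_iff, not_or]
  exact ⟨EReal.coe_ne_bot _, sum_g_ne_bot _ x⟩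

lemma toReal_F {x : Vec n} (hx : P.Dom x) : (P.F x).toReal = P.FReal x := by
  rw [F_eq_coe hx, EReal.toReal_coe]

lemma dom_iff_F_ne_top {x : Vec n} : P.Dom x ↔ P.F x ≠ ⊤ :=
  ⟨fun h => by rw [F_eq_coe h]; exact EReal.coe_ne_top _, dom_of_F_ne_top⟩

end Problem
/-! ### One inner loop -/

section InnerLoop

variable {n k N : ℕ} {Ω : Type*} {m₀ : MeasurableSpace Ω}

/-- The displacement of the variance-reduced proximal gradient step in all blocks at once, for the
mini-batch `A`, the iterate `x`, the value `xh` that was read, and the snapshot `xt`. -/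
def Problem.vrStep (P : Problem n k N) (c : ℝ) (A : Finset (Fin N)) (x xh xt : Vec n) : Vec n :=
  P.fullStep c x (P.vhat A xh xt)

/-- What the convergence analysis uses of one inner loop with iterates `z`, reads `zhat`,
mini-batches `A` and blocks `J`; the snapshot is `z 0`, and `c` is the proximal step size. -/
structure IsInnerLoop (μ : Measure Ω) (P : Problem n k N) (c : ℝ) (m τ b : ℕ)
    (z zhat : ℕ → Ω → Vec n) (A : ℕ → Ω → Finset (Fin N)) (J : ℕ → Ω → Fin k) : Prop where
  finite_iterate : ∀ t ≤ m, FiniteValued m₀ (z t)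
  finite_read : ∀ t < m, FiniteValued m₀ (zhat t)
  finite_batch : ∀ t < m, FiniteValued m₀ (A t)
  read : ∀ t < m, ∀ ω, InconsistentRead τ t (fun u => z u ω) (zhat t ω)
  batch_card : ∀ t < m, ∀ ω, (A t ω).card = b
  dom : ∀ t ≤ m, ∀ ω, P.Dom (z t ω)
  step : ∀ t < m, ∀ ω,
    z (t + 1) ω = z t ω + P.blk (J t ω) (P.vrStep c (A t ω) (z t ω) (zhat t ω) (z 0 ω))
  solvable : ∀ t < m, ∀ᵐ ω ∂μ, P.ProxSolvable c (z t ω) (P.vhat (A t ω) (zhat t ω) (z 0 ω))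
  draw : ∀ t < m, ∀ φ : Vec n × Vec n × Vec n → Finset (Fin N) → Fin k → ℝ,
    ∫ ω, φ (z t ω, zhat t ω, z 0 ω) (A t ω) (J t ω) ∂μ =
      ∫ ω, ((N.choose b : ℝ) * k)⁻¹ * ∑ S ∈ Finset.powersetCard b Finset.univ, ∑ j,
        φ (z t ω, zhat t ω, z 0 ω) S j ∂μ

/-- A read takes finitely many values when the earlier iterates do, because there are finitely many
ways to mask the earlier updates. -/
lemma finite_range_of_inconsistentRead {τ t : ℕ} {z : ℕ → Ω → Vec n} {zhat : Ω → Vec n}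
    (hz : ∀ u ≤ t, (Set.range (z u)).Finite)
    (hr : ∀ ω, InconsistentRead τ t (fun u => z u ω) (zhat ω)) : (Set.range zhat).Finite := by
  classical
  let Ψ : (Fin (t + 1) → Vec n) → (Fin t → Finset (Fin n)) → Vec n := fun y M =>
    WithLp.toLp 2 fun c => y (Fin.last t) c
      - ∑ u : Fin t, if c ∈ M u then y u.succ c - y u.castSucc c else 0
  have hfin : {y : Fin (t + 1) → Vec n | ∀ u : Fin (t + 1), y u ∈ Set.range (z u)}.Finite :=
    Set.Finite.pi' fun u : Fin (t + 1) => hz u (Nat.lt_succ_iff.1 u.2)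
  refine (Set.Finite.image2 Ψ hfin (Set.finite_univ)).subset ?_
  rintro _ ⟨ω, rfl⟩
  obtain ⟨K, B, hK, hB⟩ := hr ω
  refine ⟨fun u => z u ω, fun u => ⟨ω, rfl⟩, fun u => if (u : ℕ) ∈ K then B u else ∅,
    Set.mem_univ _, ?_⟩
  ext c
  have hsub : K ⊆ Finset.range t := fun u hu => Finset.mem_range.2 (hK u hu).1
  have h1 : ∑ u : Fin t, (if c ∈ (if (u : ℕ) ∈ K then B u else ∅) then
        z (u.succ : Fin (t + 1)) ω c - z (u.castSucc : Fin (t + 1)) ω c else 0)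
      = ∑ u ∈ K, if c ∈ B u then z (u + 1) ω c - z u ω c else 0 := by
    simp only [Fin.val_succ, Fin.val_castSucc]
    rw [Fin.sum_univ_eq_sum_range (fun u => if c ∈ (if u ∈ K then B u else ∅) then
      z (u + 1) ω c - z u ω c else 0) t, ← Finset.sum_subset hsub]
    · refine Finset.sum_congr rfl fun u hu => ?_
      rw [if_pos hu]
    · intro u _ hu
      simp [hu]
  have h2 := hB c
  simp only [Ψ, Fin.val_last]
  rw [h1]
  linarith

namespace IsRun

variable {μ : Measure Ω} {ℱ : Filtration ℕ m₀} {P : Problem n k N}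
  {Lmax γ : ℝ} {m τ b : ℕ} {x0 : Vec n} {xs : ℕ → Ω → Vec n} {x xhat : ℕ → ℕ → Ω → Vec n}
  {batch : ℕ → ℕ → Ω → Finset (Fin N)} {coord : ℕ → ℕ → Ω → Fin k}

/-- The iterate moves by one block of the full step, because proximal points are unique. -/
lemma iterate_succ (hrun : IsRun μ ℱ P Lmax γ m τ b x0 xs x xhat batch coord) (hc : 0 < γ / Lmax)
    (hx0 : P.Dom x0) {s t : ℕ} (ht : t < m) (ω : Ω) :
    x s (t + 1) ω = x s t ω +
      P.blk (coord s t ω) (P.vrStep (γ / Lmax) (batch s t ω) (x s t ω) (xhat s t ω) (xs s ω)) := by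
  have hprox := hrun.update_block s t ht ω
  refine P.ext_part fun j => ?_
  by_cases hj : j = coord s t ω
  · subst hj
    rw [Problem.part_add_blk_self]
    exact hprox.unique (Problem.isProx_fullStep ⟨_, hprox⟩) hc (P.g_ne_bot _) (P.g_convex _)
      (hx0 _)
  · rw [Problem.part_add_blk_of_ne hj]
    ext c
    exact hrun.update_off s t ht ω c.1 (by rw [c.2]; exact hj)

lemma dom (hrun : IsRun μ ℱ P Lmax γ m τ b x0 xs x xhat batch coord) (hc : 0 < γ / Lmax)
    (hx0 : P.Dom x0) (ω : Ω) : ∀ s t, t ≤ m → P.Dom (x s t ω) := by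
  have hin : ∀ s, P.Dom (xs s ω) → ∀ t, t ≤ m → P.Dom (x s t ω) := by
    intro s hs t
    induction t with
    | zero => intro _; rwa [hrun.inner_start]
    | succ t ih =>
      intro ht j
      by_cases hj : j = coord s t ω
      · subst hj
        exact (hrun.update_block s t ht ω).ne_top hc (P.g_ne_bot _) (hx0 _)
      · rw [hrun.iterate_succ hc hx0 ht ω, Problem.part_add_blk_of_ne hj]
        exact ih (by omega) j
  intro s
  induction s with
  | zero => exact hin 0 (by rwa [hrun.start])
  | succ s ih => exact hin _ (by rw [hrun.outer_step]; exact ih m le_rfl)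

lemma finite_range (hrun : IsRun μ ℱ P Lmax γ m τ b x0 xs x xhat batch coord) (hc : 0 < γ / Lmax)
    (hx0 : P.Dom x0) : ∀ s t, t ≤ m → (Set.range (x s t)).Finite := by
  have hin : ∀ s, (Set.range (xs s)).Finite → ∀ t, t ≤ m → (Set.range (x s t)).Finite := by
    intro s hs t
    induction t using Nat.strong_induction_on with
    | _ t ih =>
      intro ht
      rcases t with _ | t
      · rwa [show x s 0 = xs s from funext fun ω => hrun.inner_start s ω]
      · have hx : (Set.range (x s t)).Finite := ih t (by omega) (by omega)
        have hxh : (Set.range (xhat s t)).Finite := finite_range_of_inconsistentRead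
          (fun u hu => ih u (by omega) (by omega)) (hrun.read s t ht)
        refine ((((hx.prod hxh).prod hs).prod
          (Set.finite_univ (α := Finset (Fin N) × Fin k))).image fun q =>
            q.1.1.1 + P.blk q.2.2 (P.vrStep (γ / Lmax) q.2.1 q.1.1.1 q.1.1.2 q.1.2)).subset ?_
        rintro _ ⟨ω, rfl⟩
        exact ⟨(((x s t ω, xhat s t ω), xs s ω), (batch s t ω, coord s t ω)),
          ⟨⟨⟨⟨ω, rfl⟩, ⟨ω, rfl⟩⟩, ⟨ω, rfl⟩⟩, Set.mem_univ _⟩, (hrun.iterate_succ hc hx0 ht ω).symm⟩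
  intro s
  induction s with
  | zero =>
    refine hin 0 ((Set.finite_singleton x0).subset ?_)
    rintro _ ⟨ω, rfl⟩
    exact hrun.start ω
  | succ s ih =>
    refine hin _ ?_
    rw [show xs (s + 1) = x s m from funext fun ω => hrun.outer_step s ω]
    exact ih m le_rfl

lemma isInnerLoop [IsProbabilityMeasure μ]
    (hrun : IsRun μ ℱ P Lmax γ m τ b x0 xs x xhat batch coord) (hc : 0 < γ / Lmax)
    (hx0 : P.Dom x0) (s : ℕ) :
    IsInnerLoop μ P (γ / Lmax) m τ b (x s) (xhat s) (batch s) (coord s) := by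
  have hx : ∀ t ≤ m, FiniteValued (ℱ (s * m + t)) (x s t) := fun t ht =>
    ⟨hrun.finite_range hc hx0 s t ht,
      fun a => hrun.x_adapted s t ht (measurableSet_singleton a)⟩
  have hxh : ∀ t < m, FiniteValued (ℱ (s * m + t)) (xhat s t) := fun t ht =>
    ⟨finite_range_of_inconsistentRead
        (fun u hu => hrun.finite_range hc hx0 s u (by omega)) (hrun.read s t ht),
      fun a => hrun.xhat_adapted s t ht (measurableSet_singleton a)⟩
  have hpast : ∀ t < m,
      FiniteValued (ℱ (s * m + t)) (fun ω => (x s t ω, xhat s t ω, x s 0 ω)) := fun t ht =>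
    (hx t ht.le).prodMk ((hxh t ht).prodMk ((hx 0 (by omega)).mono (ℱ.mono (by omega))))
  have hdraw : ∀ t < m, FiniteValued m₀ (fun ω => (batch s t ω, coord s t ω)) := fun t ht =>
    ⟨Set.toFinite _, fun d => by
      have h := ℱ.le _ _ (hrun.draw_measurable s t ht d.1 d.2)
      convert h using 1
      ext ω
      simp [Prod.ext_iff]⟩
  let S : Finset (Finset (Fin N) × Fin k) := Finset.powersetCard b Finset.univ ×ˢ Finset.univ
  have hS : (S.card : ℝ) = (N.choose b : ℝ) * k := by simp [S]
  have hunif : ∀ t < m, ∀ C, MeasurableSet[ℱ (s * m + t)] C → ∀ d ∈ S,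
      μ.real (C ∩ (fun ω => (batch s t ω, coord s t ω)) ⁻¹' {d}) = μ.real C / S.card := by
    intro t ht C hC d hd
    have hd1 : d.1.card = b := (Finset.mem_powersetCard.1 (Finset.mem_product.1 hd).1).2
    rw [hS, ← hrun.draw_uniform s t ht C hC d.1 d.2 hd1]
    congr 2
    ext ω
    simp [Prod.ext_iff]
  have hmem : ∀ t < m, ∀ ω, (batch s t ω, coord s t ω) ∈ S := fun t ht ω =>
    Finset.mem_product.2 ⟨Finset.mem_powersetCard.2
      ⟨Finset.subset_univ _, hrun.batch_card s t ht ω⟩, Finset.mem_univ _⟩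
  refine ⟨fun t ht => (hx t ht).mono (ℱ.le _), fun t ht => (hxh t ht).mono (ℱ.le _),
    fun t ht => (hdraw t ht).comp Prod.fst, hrun.read s, hrun.batch_card s,
    fun t ht ω => hrun.dom hc hx0 ω s t ht, fun t ht ω => ?_, fun t ht => ?_, fun t ht φ => ?_⟩
  · rw [hrun.inner_start]
    exact hrun.iterate_succ hc hx0 ht ω
  · -- Every block is drawn with positive probability, so its proximal point exists.
    have h := ae_forall_draw (hpast t ht) (hunif t ht) (R := fun y d =>
      ∃ w, IsProx (γ / Lmax) (P.g d.2) (P.part d.2 y.1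
        - (γ / Lmax) • P.part d.2 (P.vhat d.1 y.2.1 y.2.2)) w) fun ω =>
        ⟨_, by simpa only [hrun.inner_start] using hrun.update_block s t ht ω⟩
    filter_upwards [h] with ω hω j
    exact hω (batch s t ω, j) (Finset.mem_product.2
      ⟨(Finset.mem_product.1 (hmem t ht ω)).1, Finset.mem_univ _⟩)
  · have h := integral_draw (ℱ.le _) (hpast t ht) (hdraw t ht) (hmem t ht) (hunif t ht)
      (fun y d => φ y d.1 d.2)
    simpa only [hS, S, Finset.sum_product] using h

end IsRun
end InnerLoop

/-! ### Geometric sums of delays -/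

section Geometric

/-- `r + r ^ 2 + ⋯ + r ^ τ`. -/
def geomSum (r : ℝ) (τ : ℕ) : ℝ := ∑ i ∈ Finset.range τ, r ^ (i + 1)

lemma geomSum_nonneg {r : ℝ} (hr : 0 ≤ r) (τ : ℕ) : 0 ≤ geomSum r τ :=
  Finset.sum_nonneg fun _ _ => pow_nonneg hr _

lemma geomSum_eq {r : ℝ} (hr : 1 < r) (τ : ℕ) : geomSum r τ = (r - r ^ (τ + 1)) / (1 - r) := by
  have h1 : r - 1 ≠ 0 := by linarith
  have h2 : 1 - r ≠ 0 := by linarith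
  have h3 : geomSum r τ = r * ∑ i ∈ Finset.range τ, r ^ i := by
    rw [geomSum, Finset.mul_sum]
    exact Finset.sum_congr rfl fun i _ => pow_succ' r i
  rw [h3, geom_sum_eq hr.ne' τ]
  field_simp
  ring

lemma rpow_half_eq_sqrt_pow {ρ : ℝ} (hρ : 0 ≤ ρ) (n : ℕ) : ρ ^ ((n : ℝ) / 2) = √ρ ^ n := by
  rw [Real.sqrt_eq_rpow, ← Real.rpow_natCast, ← Real.rpow_mul hρ]
  congr 1
  ring

lemma theta1_eq {ρ : ℝ} (hρ : 1 < ρ) (τ : ℕ) : theta1 ρ τ = geomSum (√ρ) τ := by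
  rw [theta1, geomSum_eq (Real.lt_sqrt_of_sq_lt (by simpa using hρ)), ← Real.sqrt_eq_rpow]
  have h := rpow_half_eq_sqrt_pow (by linarith : 0 ≤ ρ) (τ + 1)
  rw [← h]
  push_cast
  rfl

lemma theta2_eq {ρ : ℝ} (hρ : 1 < ρ) (m : ℕ) : theta2 ρ (m + 1) = geomSum (√ρ) m := by
  rw [← theta1_eq hρ, theta1, theta2]
  push_cast
  rfl

lemma theta'_eq {ρ : ℝ} (hρ : 1 < ρ) (τ : ℕ) : theta' ρ τ = geomSum ρ τ := by
  rw [theta', geomSum_eq hρ, ← neg_sub (ρ ^ (τ + 1)), ← neg_sub ρ 1, neg_div_neg_eq]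

lemma sum_pow_delay_le {r : ℝ} (hr : 0 ≤ r) {W : Finset ℕ} {t τ : ℕ}
    (hW : ∀ i ∈ W, i < t ∧ t - i ≤ τ) : ∑ i ∈ W, r ^ (t - i) ≤ geomSum r τ := by
  have h1 : ∑ i ∈ W, r ^ (t - i) = ∑ e ∈ W.image (fun i => t - i - 1), r ^ (e + 1) := by
    rw [Finset.sum_image]
    · refine Finset.sum_congr rfl fun i hi => ?_
      have := hW i hi
      congr 1
      omega
    · intro i hi j hj hij
      have h1 := hW i hi
      have h2 := hW j hj
      simp only at hij
      omega
  rw [h1]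
  refine Finset.sum_le_sum_of_subset_of_nonneg ?_ fun _ _ _ => pow_nonneg hr _
  intro e he
  obtain ⟨i, hi, rfl⟩ := Finset.mem_image.1 he
  have := hW i hi
  rw [Finset.mem_range]
  omega

end Geometric

/-! ### The expected step length along a run with delays -/

section Growth

variable {Ω : Type*} {m₀ : MeasurableSpace Ω} {μ : Measure Ω} [IsFiniteMeasure μ]

lemma FiniteValued.sum {ι : Type*} {W : Finset ι} {Y : ι → Ω → ℝ}
    (hY : ∀ i ∈ W, FiniteValued m₀ (Y i)) : FiniteValued m₀ (fun ω => ∑ i ∈ W, Y i ω) := by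
  classical
  induction W using Finset.induction_on with
  | empty =>
    exact ⟨(Set.finite_singleton 0).subset (by rintro _ ⟨ω, rfl⟩; simp), fun a => by
      by_cases h : (0 : ℝ) = a <;> simp [h]⟩
  | insert i W hi ih =>
    simp only [Finset.sum_insert hi]
    exact ((hY i (Finset.mem_insert_self i W)).prodMk
      (ih fun j hj => hY j (Finset.mem_insert_of_mem hj))).comp fun z => z.1 + z.2

/-- Minkowski's inequality, in terms of bounds on the second moments. -/
lemma integral_sum_sq_le {ι : Type*} {W : Finset ι} {Y : ι → Ω → ℝ}
    (hY : ∀ i ∈ W, FiniteValued m₀ (Y i)) {b : ι → ℝ} (hb : ∀ i ∈ W, 0 ≤ b i) {C : ℝ}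
    (h : ∀ i ∈ W, ∫ ω, Y i ω ^ 2 ∂μ ≤ b i ^ 2 * C) :
    ∫ ω, (∑ i ∈ W, Y i ω) ^ 2 ∂μ ≤ (∑ i ∈ W, b i) ^ 2 * C := by
  have hprod : ∀ i ∈ W, ∀ j ∈ W, Integrable (fun ω => Y i ω * Y j ω) μ := fun i hi j hj =>
    (((hY i hi).prodMk (hY j hj)).comp fun z => z.1 * z.2).integrable
  simp only [pow_two, Finset.sum_mul_sum]
  rw [integral_finsetSum _ fun i hi => integrable_finsetSum _ fun j hj => hprod i hi j hj,
    Finset.sum_mul]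
  refine Finset.sum_le_sum fun i hi => ?_
  rw [integral_finsetSum _ fun j hj => hprod i hi j hj, Finset.sum_mul]
  exact Finset.sum_le_sum fun j hj => integral_mul_le_of_integral_sq_le (hY i hi) (hY j hj)
    (hb i hi) (hb j hj) (h i hi) (h j hj)

/-- The iterations that a read at iteration `t` can miss. -/
def delayWindow (τ t : ℕ) : Finset ℕ := Finset.Ico (t - τ) t

lemma mem_delayWindow {τ t i : ℕ} : i ∈ delayWindow τ t ↔ i < t ∧ t - i ≤ τ := by
  rw [delayWindow, Finset.mem_Ico]
  omega

variable {X δ : ℕ → Ω → ℝ} {m τ : ℕ} {ρ K : ℝ}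

/-- Second moments of sums of earlier steps, when the second moments of the full steps shrink by
at most the factor `ρ` per iteration. -/
lemma integral_sum_sq_le_of_growth (hρ : 0 ≤ ρ) (hK : 0 < K)
    (hδ : ∀ t < m, FiniteValued m₀ (δ t))
    (hδX : ∀ t < m, ∫ ω, δ t ω ^ 2 ∂μ = K⁻¹ * ∫ ω, X t ω ^ 2 ∂μ) {t : ℕ} (ht : t < m)
    (hV : ∀ i ≤ t, ∫ ω, X i ω ^ 2 ∂μ ≤ ρ ^ (t - i) * ∫ ω, X t ω ^ 2 ∂μ)
    {W : Finset ℕ} (hW : ∀ i ∈ W, i ≤ t) :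
    ∫ ω, (∑ i ∈ W, δ i ω) ^ 2 ∂μ ≤
      ((∑ i ∈ W, √ρ ^ (t - i)) / √K) ^ 2 * ∫ ω, X t ω ^ 2 ∂μ := by
  rw [Finset.sum_div]
  refine integral_sum_sq_le (fun i hi => hδ i ((hW i hi).trans_lt ht))
    (fun i _ => by positivity) fun i hi => ?_
  rw [hδX i ((hW i hi).trans_lt ht), div_pow, Real.sq_sqrt hK.le, ← pow_mul, mul_comm (t - i),
    pow_mul, Real.sq_sqrt hρ, div_eq_inv_mul, mul_assoc]
  exact mul_le_mul_of_nonneg_left (hV i (hW i hi)) (by positivity)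

/-- The full steps `X` cannot shrink fast: if consecutive full steps differ by at most the partial
steps `δ` made within the delay window (weight `L₁`) and since the start (weight `L₂`), then the
second moments of `X` decrease by at most the factor `ρ` per iteration. -/
lemma growth_of_step_le (hρ : 1 < ρ) (hK : 0 < K) {c L₁ L₂ : ℝ} (hc : 0 ≤ c) (hL₁ : 0 ≤ L₁)
    (hL₂ : 0 ≤ L₂) (hX : ∀ t < m, FiniteValued m₀ (X t)) (hδ : ∀ t < m, FiniteValued m₀ (δ t))
    (hX0 : ∀ t ω, 0 ≤ X t ω)
    (hδX : ∀ t < m, ∫ ω, δ t ω ^ 2 ∂μ = K⁻¹ * ∫ ω, X t ω ^ 2 ∂μ)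
    (hdiff : ∀ t, t + 1 < m → ∀ᵐ ω ∂μ, X t ω - X (t + 1) ω ≤ 2 * δ t ω + c *
      (L₁ * (∑ i ∈ delayWindow τ (t + 1), δ i ω + ∑ i ∈ delayWindow τ t, δ i ω)
        + L₂ * (∑ i ∈ Finset.range (t + 1), δ i ω + ∑ i ∈ Finset.range t, δ i ω)))
    (hstep : 4 * (1 + c * (L₁ * (1 + geomSum (√ρ) τ) + L₂ * (1 + geomSum (√ρ) (m - 1)))) ≤
      √K * (1 - ρ⁻¹)) {t : ℕ} (ht : t < m) :
    ∀ i ≤ t, ∫ ω, X i ω ^ 2 ∂μ ≤ ρ ^ (t - i) * ∫ ω, X t ω ^ 2 ∂μ := by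
  induction t with
  | zero =>
    intro i hi
    obtain rfl : i = 0 := by omega
    simp
  | succ t ih =>
    have hV := ih (by omega)
    set V := ∫ ω, X t ω ^ 2 ∂μ with hVdef
    have hV0 : 0 ≤ V := integral_nonneg fun ω => sq_nonneg _
    set r := √ρ
    have hr : 0 ≤ r := Real.sqrt_nonneg _
    have hsK : 0 < √K := Real.sqrt_pos.2 hK
    have htm : t < m := by omega
    let S : Finset ℕ → ℝ := fun W => ∑ i ∈ W, r ^ (t - i)
    have hS0 : ∀ W, 0 ≤ S W := fun W => Finset.sum_nonneg fun i _ => pow_nonneg hr _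
    have hfin : ∀ W : Finset ℕ, (∀ i ∈ W, i ≤ t) → FiniteValued m₀ (fun ω => ∑ i ∈ W, δ i ω) :=
      fun W hW => FiniteValued.sum fun i hi => hδ i ((hW i hi).trans_lt htm)
    have hcross : ∀ W : Finset ℕ, (∀ i ∈ W, i ≤ t) →
        ∫ ω, X t ω * ∑ i ∈ W, δ i ω ∂μ ≤ S W / √K * V := by
      intro W hW
      have h := integral_mul_le_of_integral_sq_le (μ := μ) (a := 1) (b := S W / √K) (C := V)
        (hX t htm) (hfin W hW) zero_le_one (div_nonneg (hS0 W) hsK.le) (by rw [one_pow, one_mul])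
        (integral_sum_sq_le_of_growth (by linarith) hK hδ hδX htm hV hW)
      rwa [one_mul] at h
    have hint : ∀ W : Finset ℕ, (∀ i ∈ W, i ≤ t) →
        Integrable (fun ω => X t ω * ∑ i ∈ W, δ i ω) μ := fun W hW =>
      (((hX t htm).prodMk (hfin W hW)).comp fun z => z.1 * z.2).integrable
    have w1 : ∀ i ∈ delayWindow τ (t + 1), i ≤ t := fun i hi => by
      rw [mem_delayWindow] at hi; omega
    have w2 : ∀ i ∈ delayWindow τ t, i ≤ t := fun i hi => by
      rw [mem_delayWindow] at hi; omega
    have w3 : ∀ i ∈ Finset.range (t + 1), i ≤ t := fun i hi => by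
      rw [Finset.mem_range] at hi; omega
    have w4 : ∀ i ∈ Finset.range t, i ≤ t := fun i hi => by
      rw [Finset.mem_range] at hi; omega
    have w0 : ∀ i ∈ ({t} : Finset ℕ), i ≤ t := by simp
    have i0 : Integrable (fun ω => 2 * (X t ω * ∑ i ∈ {t}, δ i ω)) μ := (hint _ w0).const_mul 2
    have i12 : Integrable (fun ω => X t ω * ∑ i ∈ delayWindow τ (t + 1), δ i ω
        + X t ω * ∑ i ∈ delayWindow τ t, δ i ω) μ := (hint _ w1).add (hint _ w2)
    have i34 : Integrable (fun ω => X t ω * ∑ i ∈ Finset.range (t + 1), δ i ω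
        + X t ω * ∑ i ∈ Finset.range t, δ i ω) μ := (hint _ w3).add (hint _ w4)
    have i1234 : Integrable (fun ω =>
        L₁ * (X t ω * ∑ i ∈ delayWindow τ (t + 1), δ i ω + X t ω * ∑ i ∈ delayWindow τ t, δ i ω)
        + L₂ * (X t ω * ∑ i ∈ Finset.range (t + 1), δ i ω
          + X t ω * ∑ i ∈ Finset.range t, δ i ω)) μ :=
      (i12.const_mul L₁).add (i34.const_mul L₂)
    -- Multiply the bound on `X t - X (t + 1)` by `2 X t`, which dominates
    -- `X t ^ 2 - X (t + 1) ^ 2`, and take expectations.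
    have hmain : V - ∫ ω, X (t + 1) ω ^ 2 ∂μ ≤ 2 * (2 * (S {t} / √K * V) + c *
        (L₁ * (S (delayWindow τ (t + 1)) / √K * V + S (delayWindow τ t) / √K * V)
        + L₂ * (S (Finset.range (t + 1)) / √K * V + S (Finset.range t) / √K * V))) := by
      rw [hVdef, ← integral_sub ((hX t htm).comp fun x => x ^ 2).integrable
        ((hX (t + 1) ht).comp fun x => x ^ 2).integrable]
      calc ∫ ω, X t ω ^ 2 - X (t + 1) ω ^ 2 ∂μ
          ≤ ∫ ω, 2 * (2 * (X t ω * ∑ i ∈ {t}, δ i ω) + c *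
            (L₁ * (X t ω * ∑ i ∈ delayWindow τ (t + 1), δ i ω
                + X t ω * ∑ i ∈ delayWindow τ t, δ i ω)
              + L₂ * (X t ω * ∑ i ∈ Finset.range (t + 1), δ i ω
                + X t ω * ∑ i ∈ Finset.range t, δ i ω))) ∂μ := by
            refine integral_mono_ae
              (((hX t htm).prodMk (hX (t + 1) ht)).comp fun z => z.1 ^ 2 - z.2 ^ 2).integrable
              ((i0.add (i1234.const_mul c)).const_mul 2) ?_
            filter_upwards [hdiff t ht] with ω hω
            have h1 := mul_le_mul_of_nonneg_left hω (hX0 t ω)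
            simp only [Finset.sum_singleton]
            nlinarith [sq_nonneg (X t ω - X (t + 1) ω)]
        _ = 2 * (2 * (∫ ω, X t ω * ∑ i ∈ {t}, δ i ω ∂μ) + c *
            (L₁ * ((∫ ω, X t ω * ∑ i ∈ delayWindow τ (t + 1), δ i ω ∂μ)
                + ∫ ω, X t ω * ∑ i ∈ delayWindow τ t, δ i ω ∂μ)
              + L₂ * ((∫ ω, X t ω * ∑ i ∈ Finset.range (t + 1), δ i ω ∂μ)
                + ∫ ω, X t ω * ∑ i ∈ Finset.range t, δ i ω ∂μ))) := by
            rw [integral_const_mul, integral_add i0 (i1234.const_mul c), integral_const_mul,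
              integral_const_mul, integral_add (i12.const_mul L₁) (i34.const_mul L₂),
              integral_const_mul, integral_const_mul, integral_add (hint _ w1) (hint _ w2),
              integral_add (hint _ w3) (hint _ w4)]
        _ ≤ _ := by
            gcongr
            · exact hcross _ w0
            · exact hcross _ w1
            · exact hcross _ w2
            · exact hcross _ w3
            · exact hcross _ w4
    have s0 : S {t} = 1 := by simp [S]
    have s2 : S (delayWindow τ t) ≤ geomSum r τ :=
      sum_pow_delay_le hr fun i hi => mem_delayWindow.1 hi
    have s1 : S (delayWindow τ (t + 1)) ≤ 1 + S (delayWindow τ t) := by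
      have hsub : delayWindow τ (t + 1) ⊆ insert t (delayWindow τ t) := by
        intro i hi
        rw [mem_delayWindow] at hi
        rw [Finset.mem_insert, mem_delayWindow]
        omega
      refine (Finset.sum_le_sum_of_subset_of_nonneg hsub fun _ _ _ => pow_nonneg hr _).trans ?_
      rw [Finset.sum_insert (by simp [mem_delayWindow])]
      simp [S]
    have s4 : S (Finset.range t) ≤ geomSum r (m - 1) :=
      sum_pow_delay_le hr fun i hi => by rw [Finset.mem_range] at hi; omega
    have s3 : S (Finset.range (t + 1)) = 1 + S (Finset.range t) := by
      simp only [S]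
      rw [Finset.sum_range_succ]
      simp [add_comm]
    have hfactor : V - ∫ ω, X (t + 1) ω ^ 2 ∂μ ≤ (1 - ρ⁻¹) * V := by
      refine hmain.trans ?_
      have e1 : 2 * (2 * (S {t} / √K * V) + c *
          (L₁ * (S (delayWindow τ (t + 1)) / √K * V + S (delayWindow τ t) / √K * V)
          + L₂ * (S (Finset.range (t + 1)) / √K * V + S (Finset.range t) / √K * V)))
          = (2 * (2 * S {t} + c * (L₁ * (S (delayWindow τ (t + 1)) + S (delayWindow τ t))
            + L₂ * (S (Finset.range (t + 1)) + S (Finset.range t))))) / √K * V := by ring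
      rw [e1]
      refine mul_le_mul_of_nonneg_right ?_ hV0
      rw [div_le_iff₀ hsK, mul_comm (1 - ρ⁻¹)]
      refine le_trans ?_ hstep
      have e2 : L₁ * (S (delayWindow τ (t + 1)) + S (delayWindow τ t)) ≤
          L₁ * (2 * (1 + geomSum r τ)) := mul_le_mul_of_nonneg_left (by linarith) hL₁
      have e3 : L₂ * (S (Finset.range (t + 1)) + S (Finset.range t)) ≤
          L₂ * (2 * (1 + geomSum r (m - 1))) := mul_le_mul_of_nonneg_left (by linarith) hL₂
      have e4 := mul_le_mul_of_nonneg_left (add_le_add e2 e3) hc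
      rw [s0]
      linarith
    have hstep1 : V ≤ ρ * ∫ ω, X (t + 1) ω ^ 2 ∂μ := by
      have h1 : ρ⁻¹ * V ≤ ∫ ω, X (t + 1) ω ^ 2 ∂μ := by linarith
      rwa [inv_mul_le_iff₀ (by linarith)] at h1
    intro i hi
    rcases hi.lt_or_eq with h | rfl
    · have hi' : i ≤ t := by omega
      refine (hV i hi').trans ?_
      rw [show t + 1 - i = (t - i) + 1 by omega, pow_succ, mul_assoc]
      exact mul_le_mul_of_nonneg_left hstep1 (by positivity)
    · simp

end Growth

/-! ### Steps and reads of an inner loop -/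

namespace IsInnerLoop

variable {n k N : ℕ} {Ω : Type*} {m₀ : MeasurableSpace Ω} {μ : Measure Ω}
  {P : Problem n k N} {c : ℝ} {m τ b : ℕ} {z zhat : ℕ → Ω → Vec n}
  {A : ℕ → Ω → Finset (Fin N)} {J : ℕ → Ω → Fin k}

/-- The full step, in all blocks, that iteration `t` would make with its mini-batch. -/
def full (P : Problem n k N) (c : ℝ) (z zhat : ℕ → Ω → Vec n) (A : ℕ → Ω → Finset (Fin N))
    (t : ℕ) (ω : Ω) : Vec n :=
  P.vrStep c (A t ω) (z t ω) (zhat t ω) (z 0 ω)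

/-- The length of the step actually made at iteration `t`. -/
def move (z : ℕ → Ω → Vec n) (t : ℕ) (ω : Ω) : ℝ := ‖z (t + 1) ω - z t ω‖

lemma finite_state (h : IsInnerLoop μ P c m τ b z zhat A J) {t : ℕ} (ht : t < m) :
    FiniteValued m₀ (fun ω => ((z t ω, zhat t ω, z 0 ω), A t ω)) :=
  ((h.finite_iterate t ht.le).prodMk ((h.finite_read t ht).prodMk
    (h.finite_iterate 0 (Nat.zero_le m)))).prodMk (h.finite_batch t ht)

lemma finite_move (h : IsInnerLoop μ P c m τ b z zhat A J) (t : ℕ) (ht : t < m) :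
    FiniteValued m₀ (move z t) :=
  ((h.finite_iterate (t + 1) ht).prodMk (h.finite_iterate t ht.le)).comp fun y => ‖y.1 - y.2‖

lemma finite_norm_full (h : IsInnerLoop μ P c m τ b z zhat A J) (t : ℕ) (ht : t < m) :
    FiniteValued m₀ (fun ω => ‖full P c z zhat A t ω‖) :=
  (h.finite_state ht).comp fun y => ‖P.vrStep c y.2 y.1.1 y.1.2.1 y.1.2.2‖

lemma iterate_succ_sub (h : IsInnerLoop μ P c m τ b z zhat A J) {t : ℕ} (ht : t < m) (ω : Ω) :
    z (t + 1) ω - z t ω = P.blk (J t ω) (full P c z zhat A t ω) := by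
  rw [h.step t ht ω, add_sub_cancel_left]
  rfl

/-- Expectation over the block: every block has probability `1 / k` given the past and the
mini-batch. -/
lemma integral_draw_block (h : IsInnerLoop μ P c m τ b z zhat A J) (hk : 0 < k) {t : ℕ}
    (ht : t < m) (φ : Vec n × Vec n × Vec n → Finset (Fin N) → Fin k → ℝ) :
    ∫ ω, φ (z t ω, zhat t ω, z 0 ω) (A t ω) (J t ω) ∂μ =
      (k : ℝ)⁻¹ * ∫ ω, ∑ j, φ (z t ω, zhat t ω, z 0 ω) (A t ω) j ∂μ := by
  have hk' : (k : ℝ) ≠ 0 := by positivity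
  rw [h.draw t ht φ, h.draw t ht (fun y S _ => ∑ j, φ y S j), ← integral_const_mul]
  congr 1
  ext ω
  simp only [Finset.sum_const, Finset.card_univ, Fintype.card_fin, nsmul_eq_mul,
    ← Finset.mul_sum]
  field_simp

/-- Expectation over the mini-batch. -/
lemma integral_draw_batch (h : IsInnerLoop μ P c m τ b z zhat A J) (hk : 0 < k) {t : ℕ}
    (ht : t < m) (φ : Vec n × Vec n × Vec n → Finset (Fin N) → ℝ) :
    ∫ ω, φ (z t ω, zhat t ω, z 0 ω) (A t ω) ∂μ =
      ∫ ω, (N.choose b : ℝ)⁻¹ * ∑ S ∈ Finset.powersetCard b Finset.univ,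
        φ (z t ω, zhat t ω, z 0 ω) S ∂μ := by
  have hk' : (k : ℝ) ≠ 0 := by positivity
  rw [h.draw t ht (fun y S _ => φ y S)]
  congr 1
  ext ω
  simp only [Finset.sum_const, Finset.card_univ, Fintype.card_fin, nsmul_eq_mul,
    ← Finset.mul_sum]
  field_simp

lemma integral_move_sq (h : IsInnerLoop μ P c m τ b z zhat A J) (hk : 0 < k) {t : ℕ}
    (ht : t < m) :
    ∫ ω, move z t ω ^ 2 ∂μ = (k : ℝ)⁻¹ * ∫ ω, ‖full P c z zhat A t ω‖ ^ 2 ∂μ := by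
  simp only [move, h.iterate_succ_sub ht]
  refine (h.integral_draw_block hk ht
    (fun y S j => ‖P.blk j (P.vrStep c S y.1 y.2.1 y.2.2)‖ ^ 2)).trans ?_
  simp only [P.sum_norm_blk_sq]
  rfl

lemma norm_sub_start_le (z : ℕ → Ω → Vec n) (t : ℕ) (ω : Ω) :
    ‖z t ω - z 0 ω‖ ≤ ∑ i ∈ Finset.range t, move z i ω := by
  rw [← Finset.sum_range_sub (fun i => z i ω) t]
  exact norm_sum_le _ _

/-- The missed updates of a read, as vectors each supported on one block. -/
lemma exists_read_decomposition (h : IsInnerLoop μ P c m τ b z zhat A J) {t : ℕ} (ht : t < m)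
    (ω : Ω) : ∃ (K : Finset ℕ) (D : ℕ → Vec n), K ⊆ delayWindow τ t ∧
      z t ω = zhat t ω + ∑ i ∈ K, D i ∧ (∀ i, P.SupportedOn (J i ω) (D i)) ∧
      ∑ i ∈ K, ‖D i‖ ≤ ∑ i ∈ delayWindow τ t, move z i ω := by
  classical
  obtain ⟨K, B, hK, hB⟩ := h.read t ht ω
  have hsub : K ⊆ delayWindow τ t := fun i hi =>
    mem_delayWindow.2 ⟨(hK i hi).1, (hK i hi).2.1⟩
  let D : ℕ → Vec n := fun i => if i ∈ K then
    WithLp.toLp 2 (fun c => if c ∈ B i then z (i + 1) ω c - z i ω c else 0) else 0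
  have hD : ∀ i ∈ K, ∀ c, D i c = if c ∈ B i then z (i + 1) ω c - z i ω c else 0 := by
    intro i hi c
    simp only [D, if_pos hi]
  refine ⟨K, D, hsub, ?_, fun i c hc => ?_, ?_⟩
  · ext c
    rw [hB c]
    simp only [PiLp.add_apply, WithLp.ofLp_sum, Finset.sum_apply]
    congr 1
    exact Finset.sum_congr rfl fun i hi => (hD i hi c).symm
  · by_cases hi : i ∈ K
    · rw [hD i hi]
      have hit : i < m := ((hK i hi).1).trans ht
      have h1 := congrArg (fun v : Vec n => v c) (h.iterate_succ_sub hit ω)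
      simp only [PiLp.sub_apply, Problem.blk_apply, if_neg hc] at h1
      rw [h1, ite_self]
    · simp [D, hi]
  · refine (Finset.sum_le_sum fun i hi => ?_).trans
      (Finset.sum_le_sum_of_subset_of_nonneg hsub fun i _ _ => norm_nonneg _)
    refine le_of_sq_le_sq ?_ (norm_nonneg _)
    rw [move, EuclideanSpace.norm_sq_eq, EuclideanSpace.norm_sq_eq]
    refine Finset.sum_le_sum fun c _ => ?_
    rw [hD i hi c]
    split_ifs
    · exact le_rfl
    · rw [norm_zero, zero_pow two_ne_zero]
      exact sq_nonneg _

variable {Lnor Lres Lmax : ℝ}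

lemma norm_gradAvg_read_le (h : IsInnerLoop μ P c m τ b z zhat A J)
    (hres : P.BlockRestrictedLipschitz Lres) (hL : 0 ≤ Lres) {t : ℕ} (ht : t < m) (ω : Ω)
    {S : Finset (Fin N)} (hS : S.Nonempty) :
    ‖P.gradAvg S (z t ω) - P.gradAvg S (zhat t ω)‖ ≤
      Lres * ∑ i ∈ delayWindow τ t, move z i ω := by
  obtain ⟨K, D, -, hz, hD, hle⟩ := h.exists_read_decomposition ht ω
  rw [hz]
  exact (Problem.norm_gradAvg_sub_le hS fun i => hres.norm_sub_le_sum hD i _ K).trans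
    (mul_le_mul_of_nonneg_left hle hL)

/-- Convexity at the value that was read, combined with the upper bound for `f` along the missed
updates. -/
lemma inner_fullGrad_read_le (h : IsInnerLoop μ P c m τ b z zhat A J) [NeZero N]
    (hmax : P.BlockCoordinateLipschitz Lmax) (hL : 0 ≤ Lmax) {t : ℕ} (ht : t < m) (ω : Ω)
    (p : Vec n) :
    ⟪P.fullGrad (zhat t ω), p - z t ω⟫_ℝ ≤ P.fReal p - P.fReal (z t ω) +
      Lmax / 2 * (∑ i ∈ delayWindow τ t, move z i ω) ^ 2 := by
  obtain ⟨K, D, -, hz, hD, hle⟩ := h.exists_read_decomposition ht ω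
  have h1 := ConvexOn.add_inner_le P.convexOn_fReal P.hasGradientAt_fReal (zhat t ω) p
  have h2 := hmax.fReal_add_sum_le hD (zhat t ω) K
  have h3 : (∑ i ∈ K, ‖D i‖) ^ 2 ≤ (∑ i ∈ delayWindow τ t, move z i ω) ^ 2 :=
    pow_le_pow_left₀ (Finset.sum_nonneg fun i _ => norm_nonneg _) hle 2
  have h4 := mul_le_mul_of_nonneg_left h3 (by linarith : 0 ≤ Lmax / 2)
  have h5 : ⟪P.fullGrad (zhat t ω), p - z t ω⟫_ℝ = ⟪P.fullGrad (zhat t ω), p - zhat t ω⟫_ℝ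
      - ⟪P.fullGrad (zhat t ω), ∑ i ∈ K, D i⟫_ℝ := by
    rw [← inner_sub_right, hz]
    congr 1
    abel
  rw [← hz] at h2
  linarith

lemma norm_vhat_sub_le (h : IsInnerLoop μ P c m τ b z zhat A J) (hb : 1 ≤ b)
    (hnor : P.NormalLipschitz Lnor) (hLnor : 0 ≤ Lnor)
    (hres : P.BlockRestrictedLipschitz Lres) (hLres : 0 ≤ Lres) {t : ℕ} (ht : t < m) (ω : Ω) :
    ‖P.vhat (A t ω) (zhat t ω) (z 0 ω) - P.fullGrad (z 0 ω)‖ ≤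
      Lres * ∑ i ∈ delayWindow τ t, move z i ω + Lnor * ∑ i ∈ Finset.range t, move z i ω := by
  have hA : (A t ω).Nonempty := Finset.card_pos.1 (by rw [h.batch_card t ht ω]; omega)
  have h1 := h.norm_gradAvg_read_le hres hLres ht ω hA
  have h2 := (hnor.gradAvg hA (z t ω) (z 0 ω)).trans
    (mul_le_mul_of_nonneg_left (norm_sub_start_le z t ω) hLnor)
  rw [norm_sub_rev] at h1
  refine le_trans ?_ (add_le_add h1 h2)
  rw [P.vhat_eq, add_sub_cancel_right]
  exact norm_sub_le_norm_sub_add_norm_sub _ _ _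

lemma norm_full_sub_le (h : IsInnerLoop μ P c m τ b z zhat A J) (hc : 0 < c) (hb : 1 ≤ b)
    (hnor : P.NormalLipschitz Lnor) (hLnor : 0 ≤ Lnor)
    (hres : P.BlockRestrictedLipschitz Lres) (hLres : 0 ≤ Lres) {t : ℕ} (ht : t + 1 < m) :
    ∀ᵐ ω ∂μ, ‖full P c z zhat A t ω‖ - ‖full P c z zhat A (t + 1) ω‖ ≤ 2 * move z t ω + c *
      (Lres * (∑ i ∈ delayWindow τ (t + 1), move z i ω + ∑ i ∈ delayWindow τ t, move z i ω)
        + Lnor * (∑ i ∈ Finset.range (t + 1), move z i ω + ∑ i ∈ Finset.range t, move z i ω)) := by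
  filter_upwards [h.solvable t (by omega), h.solvable (t + 1) ht] with ω h1 h2
  have h3 := Problem.norm_fullStep_sub_le hc h1 h2 (h.dom 0 (Nat.zero_le m) ω)
  have h4 := h.norm_vhat_sub_le hb hnor hLnor hres hLres (show t < m by omega) ω
  have h5 := h.norm_vhat_sub_le hb hnor hLnor hres hLres ht ω
  refine (norm_sub_norm_le _ _).trans (h3.trans (add_le_add (le_of_eq ?_)
    (mul_le_mul_of_nonneg_left ?_ hc.le)))
  · rw [norm_sub_rev]; rfl
  · refine (norm_sub_le_norm_sub_add_norm_sub _ (P.fullGrad (z 0 ω)) _).trans ?_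
    rw [norm_sub_rev (P.fullGrad (z 0 ω))]
    linarith

end IsInnerLoop

/-! ### Expected errors of the delayed stochastic direction -/

/-- The mini-batch gradient is an unbiased estimate of the full gradient. -/
lemma Problem.sum_powersetCard_gradAvg {n k N b : ℕ} (P : Problem n k N) (hb : 1 ≤ b)
    (hbN : b ≤ N) (x : Vec n) :
    ∑ S ∈ Finset.powersetCard b (Finset.univ : Finset (Fin N)), P.gradAvg S x =
      (N.choose b : ℝ) • P.fullGrad x := by
  have h := sum_powersetCard_average hb (by simpa using hbN) fun i : Fin N => gradient (P.f i) x
  rw [Fintype.card_fin] at h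
  exact h

namespace IsInnerLoop

variable {n k N : ℕ} {Ω : Type*} {m₀ : MeasurableSpace Ω} {μ : Measure Ω}
  {P : Problem n k N} {c : ℝ} {m τ b : ℕ} {z zhat : ℕ → Ω → Vec n}
  {A : ℕ → Ω → Finset (Fin N)} {J : ℕ → Ω → Fin k} {Lnor Lres Lmax ρ : ℝ}

lemma growth [IsProbabilityMeasure μ] (h : IsInnerLoop μ P c m τ b z zhat A J) (hk : 0 < k)
    (hc : 0 < c) (hb : 1 ≤ b)
    (hρ : 1 < ρ) (hnor : P.NormalLipschitz Lnor) (hLnor : 0 ≤ Lnor)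
    (hres : P.BlockRestrictedLipschitz Lres) (hLres : 0 ≤ Lres)
    (hstep : 4 * (1 + c * (Lres * (1 + geomSum (√ρ) τ) + Lnor * (1 + geomSum (√ρ) (m - 1)))) ≤
      √k * (1 - ρ⁻¹)) {t : ℕ} (ht : t < m) :
    ∀ i ≤ t, ∫ ω, ‖full P c z zhat A i ω‖ ^ 2 ∂μ ≤
      ρ ^ (t - i) * ∫ ω, ‖full P c z zhat A t ω‖ ^ 2 ∂μ :=
  growth_of_step_le hρ (K := (k : ℝ)) (by positivity) hc.le hLres hLnor
    (X := fun t ω => ‖full P c z zhat A t ω‖) h.finite_norm_full h.finite_move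
    (fun _ _ => norm_nonneg _) (fun _ ht => h.integral_move_sq hk ht)
    (fun _ ht => h.norm_full_sub_le hc hb hnor hLnor hres hLres ht) hstep ht

section Progress

variable {t : ℕ}

/-- The mini-batch direction is an unbiased estimate of the gradient at the value that was
read. -/
lemma integral_inner_vhat (h : IsInnerLoop μ P c m τ b z zhat A J) (hk : 0 < k) (hb : 1 ≤ b)
    (hbN : b ≤ N) (ht : t < m) (π : Vec n → Vec n) :
    ∫ ω, ⟪P.vhat (A t ω) (zhat t ω) (z 0 ω), π (z t ω) - z t ω⟫_ℝ ∂μ =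
      ∫ ω, ⟪P.fullGrad (zhat t ω), π (z t ω) - z t ω⟫_ℝ ∂μ := by
  have hC : (N.choose b : ℝ) ≠ 0 := by exact_mod_cast (Nat.choose_pos hbN).ne'
  refine (h.integral_draw_batch hk ht
    (fun y S => ⟪P.vhat S y.2.1 y.2.2, π y.1 - y.1⟫_ℝ)).trans ?_
  congr 1
  ext ω
  have hcard : (Finset.powersetCard b (Finset.univ : Finset (Fin N))).card = N.choose b := by
    simp
  have hmean : ∀ x, ∑ S ∈ Finset.powersetCard b (Finset.univ : Finset (Fin N)), P.gradAvg S x =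
      (N.choose b : ℝ) • P.fullGrad x := P.sum_powersetCard_gradAvg hb hbN
  have hv : ∑ S ∈ Finset.powersetCard b (Finset.univ : Finset (Fin N)),
      P.vhat S (zhat t ω) (z 0 ω) = (N.choose b : ℝ) • P.fullGrad (zhat t ω) := by
    simp only [P.vhat_eq, Finset.sum_add_distrib, Finset.sum_sub_distrib, hmean, Finset.sum_const,
      hcard, ← Nat.cast_smul_eq_nsmul ℝ]
    abel
  rw [← sum_inner, hv, real_inner_smul_left, inv_mul_cancel_left₀ hC]

/-- The second moment of the mini-batch noise of the variance-reduced gradient at the current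
iterate is at most that of the uncentered difference of mini-batch gradients. -/
lemma integral_noise_sq_le [IsProbabilityMeasure μ] (h : IsInnerLoop μ P c m τ b z zhat A J)
    (hk : 0 < k) (hb : 1 ≤ b)
    (hbN : b ≤ N) (hnor : P.NormalLipschitz Lnor) (hLnor : 0 ≤ Lnor) (ht : t < m) :
    ∫ ω, ‖(P.gradAvg (A t ω) (z t ω) - P.gradAvg (A t ω) (z 0 ω))
        - (P.fullGrad (z t ω) - P.fullGrad (z 0 ω))‖ ^ 2 ∂μ ≤
      Lnor ^ 2 * ∫ ω, (∑ i ∈ Finset.range t, move z i ω) ^ 2 ∂μ := by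
  have hC : (0 : ℝ) < N.choose b := by exact_mod_cast Nat.choose_pos hbN
  have hcard : (Finset.powersetCard b (Finset.univ : Finset (Fin N))).card = N.choose b := by
    simp
  rw [← integral_const_mul]
  refine (h.integral_draw_batch hk ht (fun y S => ‖(P.gradAvg S y.1 - P.gradAvg S y.2.2)
    - (P.fullGrad y.1 - P.fullGrad y.2.2)‖ ^ 2)).trans_le ?_
  refine integral_mono ((h.finite_state ht).comp fun y => (N.choose b : ℝ)⁻¹ *
      ∑ S ∈ Finset.powersetCard b Finset.univ, ‖(P.gradAvg S y.1.1 - P.gradAvg S y.1.2.2)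
        - (P.fullGrad y.1.1 - P.fullGrad y.1.2.2)‖ ^ 2).integrable
    ((FiniteValued.sum fun i hi => h.finite_move i
      ((Finset.mem_range.1 hi).trans ht)).comp fun r => Lnor ^ 2 * r ^ 2).integrable fun ω => ?_
  simp only
  have hmean : ∀ x, ∑ S ∈ Finset.powersetCard b (Finset.univ : Finset (Fin N)), P.gradAvg S x =
      (N.choose b : ℝ) • P.fullGrad x := P.sum_powersetCard_gradAvg hb hbN
  have h1 := sum_norm_sub_mean_sq_le
    (S := Finset.powersetCard b (Finset.univ : Finset (Fin N)))
    (y := fun S => P.gradAvg S (z t ω) - P.gradAvg S (z 0 ω))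
    (m := P.fullGrad (z t ω) - P.fullGrad (z 0 ω)) (by
      rw [Finset.sum_sub_distrib, hmean, hmean, hcard, smul_sub])
  have h2 : ∑ S ∈ Finset.powersetCard b (Finset.univ : Finset (Fin N)),
      ‖P.gradAvg S (z t ω) - P.gradAvg S (z 0 ω)‖ ^ 2 ≤
      ∑ S ∈ Finset.powersetCard b (Finset.univ : Finset (Fin N)),
        Lnor ^ 2 * (∑ i ∈ Finset.range t, move z i ω) ^ 2 := by
    refine Finset.sum_le_sum fun S hS => ?_
    have hS' : S.Nonempty := Finset.card_pos.1 (by rw [(Finset.mem_powersetCard.1 hS).2]; omega)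
    rw [← mul_pow]
    exact pow_le_pow_left₀ (norm_nonneg _) ((hnor.gradAvg hS' _ _).trans
      (mul_le_mul_of_nonneg_left (norm_sub_start_le z t ω) hLnor)) 2
  rw [Finset.sum_const, hcard, nsmul_eq_mul] at h2
  rw [inv_mul_le_iff₀ hC]
  exact h1.trans h2

/-- The descent error: how much the inexact direction costs against the gradient. -/
lemma integral_inner_grad_sub_vhat_le [IsProbabilityMeasure μ]
    (h : IsInnerLoop μ P c m τ b z zhat A J) (hk : 0 < k)
    (hb : 1 ≤ b) (hbN : b ≤ N) (hρ : 0 ≤ ρ) (hnor : P.NormalLipschitz Lnor) (hLnor : 0 ≤ Lnor)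
    (hres : P.BlockRestrictedLipschitz Lres) (hLres : 0 ≤ Lres) (ht : t < m)
    (hV : ∀ i ≤ t, ∫ ω, ‖full P c z zhat A i ω‖ ^ 2 ∂μ ≤
      ρ ^ (t - i) * ∫ ω, ‖full P c z zhat A t ω‖ ^ 2 ∂μ) :
    ∫ ω, ⟪P.fullGrad (z t ω) - P.vhat (A t ω) (zhat t ω) (z 0 ω), full P c z zhat A t ω⟫_ℝ ∂μ ≤
      (Lres * geomSum (√ρ) τ + Lnor * geomSum (√ρ) (m - 1)) / √k *
        ∫ ω, ‖full P c z zhat A t ω‖ ^ 2 ∂μ := by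
  set V := ∫ ω, ‖full P c z zhat A t ω‖ ^ 2 ∂μ with hVdef
  have hV0 : 0 ≤ V := integral_nonneg fun ω => sq_nonneg _
  have hkR : (0 : ℝ) < k := by positivity
  have hsk : 0 < √(k : ℝ) := Real.sqrt_pos.2 hkR
  have hX := h.finite_norm_full t ht
  have hX1 : ∫ ω, ‖full P c z zhat A t ω‖ ^ 2 ∂μ ≤ 1 ^ 2 * V := by rw [one_pow, one_mul]
  have hsum : ∀ W : Finset ℕ, (∀ i ∈ W, i ≤ t) → ∀ T, ∑ i ∈ W, √ρ ^ (t - i) ≤ T →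
      ∫ ω, (∑ i ∈ W, move z i ω) ^ 2 ∂μ ≤ (T / √k) ^ 2 * V := by
    intro W hW T hT
    refine (integral_sum_sq_le_of_growth (X := fun t ω => ‖full P c z zhat A t ω‖) hρ hkR
      h.finite_move (fun _ ht => h.integral_move_sq hk ht) ht hV hW).trans ?_
    refine mul_le_mul_of_nonneg_right ?_ hV0
    have h0 : 0 ≤ ∑ i ∈ W, √ρ ^ (t - i) :=
      Finset.sum_nonneg fun _ _ => pow_nonneg (Real.sqrt_nonneg _) _
    gcongr
  have hfin : ∀ W : Finset ℕ, (∀ i ∈ W, i ≤ t) →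
      FiniteValued m₀ (fun ω => ∑ i ∈ W, move z i ω) := fun W hW =>
    FiniteValued.sum fun i hi => h.finite_move i ((hW i hi).trans_lt ht)
  have w1 : ∀ i ∈ delayWindow τ t, i ≤ t := fun i hi => (mem_delayWindow.1 hi).1.le
  have w2 : ∀ i ∈ Finset.range t, i ≤ t := fun i hi => (Finset.mem_range.1 hi).le
  have g1 := geomSum_nonneg (Real.sqrt_nonneg ρ) τ
  have g2 := geomSum_nonneg (Real.sqrt_nonneg ρ) (m - 1)
  have hdelay := integral_mul_le_of_integral_sq_le hX (hfin _ w1) zero_le_one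
    (div_nonneg g1 hsk.le) hX1
    (hsum _ w1 _ (sum_pow_delay_le (Real.sqrt_nonneg ρ) fun i hi => mem_delayWindow.1 hi))
  let ξ : (Vec n × Vec n × Vec n) × Finset (Fin N) → ℝ := fun y =>
    ‖(P.gradAvg y.2 y.1.1 - P.gradAvg y.2 y.1.2.2) - (P.fullGrad y.1.1 - P.fullGrad y.1.2.2)‖
  have hξ := (h.finite_state ht).comp ξ
  have hnoise := integral_mul_le_of_integral_sq_le (b := Lnor * (geomSum (√ρ) (m - 1) / √k))
    hX hξ zero_le_one (by positivity) hX1 (by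
      refine (h.integral_noise_sq_le hk hb hbN hnor hLnor ht).trans ?_
      rw [mul_pow, mul_assoc]
      exact mul_le_mul_of_nonneg_left (hsum _ w2 _ (sum_pow_delay_le (Real.sqrt_nonneg ρ)
        fun i hi => by rw [Finset.mem_range] at hi; omega)) (sq_nonneg _))
  have i1 : Integrable (fun ω => ‖full P c z zhat A t ω‖ *
      ∑ i ∈ delayWindow τ t, move z i ω) μ :=
    ((hX.prodMk (hfin _ w1)).comp fun y => y.1 * y.2).integrable
  have i2 : Integrable (fun ω => ‖full P c z zhat A t ω‖ *
      ξ ((z t ω, zhat t ω, z 0 ω), A t ω)) μ :=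
    ((hX.prodMk hξ).comp fun y => y.1 * y.2).integrable
  calc ∫ ω, ⟪P.fullGrad (z t ω) - P.vhat (A t ω) (zhat t ω) (z 0 ω),
          full P c z zhat A t ω⟫_ℝ ∂μ
      ≤ ∫ ω, Lres * (‖full P c z zhat A t ω‖ * ∑ i ∈ delayWindow τ t, move z i ω)
          + ‖full P c z zhat A t ω‖ * ξ ((z t ω, zhat t ω, z 0 ω), A t ω) ∂μ := by
        refine integral_mono ((h.finite_state ht).comp fun y =>
          ⟪P.fullGrad y.1.1 - P.vhat y.2 y.1.2.1 y.1.2.2,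
            P.vrStep c y.2 y.1.1 y.1.2.1 y.1.2.2⟫_ℝ).integrable
          ((i1.const_mul Lres).add i2) fun ω => ?_
        have hA : (A t ω).Nonempty := Finset.card_pos.1 (by rw [h.batch_card t ht ω]; omega)
        have e1 := h.norm_gradAvg_read_le hres hLres ht ω hA
        have e2 : P.fullGrad (z t ω) - P.vhat (A t ω) (zhat t ω) (z 0 ω) =
            (P.gradAvg (A t ω) (z t ω) - P.gradAvg (A t ω) (zhat t ω))
            - ((P.gradAvg (A t ω) (z t ω) - P.gradAvg (A t ω) (z 0 ω))
              - (P.fullGrad (z t ω) - P.fullGrad (z 0 ω))) := by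
          rw [P.vhat_eq]
          abel
        refine (real_inner_le_norm _ _).trans ?_
        rw [e2]
        have e3 := mul_le_mul_of_nonneg_right ((norm_sub_le
          (P.gradAvg (A t ω) (z t ω) - P.gradAvg (A t ω) (zhat t ω))
          ((P.gradAvg (A t ω) (z t ω) - P.gradAvg (A t ω) (z 0 ω))
              - (P.fullGrad (z t ω) - P.fullGrad (z 0 ω)))).trans (add_le_add_left e1 _))
          (norm_nonneg (full P c z zhat A t ω))
        refine e3.trans (le_of_eq ?_)
        simp only [ξ]
        ring
    _ = Lres * (∫ ω, ‖full P c z zhat A t ω‖ * ∑ i ∈ delayWindow τ t, move z i ω ∂μ)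
          + ∫ ω, ‖full P c z zhat A t ω‖ * ξ ((z t ω, zhat t ω, z 0 ω), A t ω) ∂μ := by
        rw [integral_add (i1.const_mul Lres) i2, integral_const_mul]
    _ ≤ Lres * (1 * (geomSum (√ρ) τ / √k) * V)
          + 1 * (Lnor * (geomSum (√ρ) (m - 1) / √k)) * V :=
        add_le_add (mul_le_mul_of_nonneg_left hdelay hLres) hnoise
    _ = _ := by ring

/-- Progress towards a target `π`: the optimality gap in `f` up to the error of the delayed
read. -/
lemma integral_inner_vhat_le [IsProbabilityMeasure μ]
    (h : IsInnerLoop μ P c m τ b z zhat A J) (hk : 0 < k)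
    (hb : 1 ≤ b) (hbN : b ≤ N) (hρ : 0 ≤ ρ) (hmax : P.BlockCoordinateLipschitz Lmax)
    (hLmax : 0 ≤ Lmax) (ht : t < m)
    (hV : ∀ i ≤ t, ∫ ω, ‖full P c z zhat A i ω‖ ^ 2 ∂μ ≤
      ρ ^ (t - i) * ∫ ω, ‖full P c z zhat A t ω‖ ^ 2 ∂μ) (π : Vec n → Vec n) :
    ∫ ω, ⟪P.vhat (A t ω) (zhat t ω) (z 0 ω), π (z t ω) - z t ω⟫_ℝ ∂μ ≤
      ∫ ω, (P.fReal (π (z t ω)) - P.fReal (z t ω)) ∂μ +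
        Lmax / 2 * (τ * geomSum ρ τ / k) * ∫ ω, ‖full P c z zhat A t ω‖ ^ 2 ∂μ := by
  set V := ∫ ω, ‖full P c z zhat A t ω‖ ^ 2 ∂μ with hVdef
  have hV0 : 0 ≤ V := integral_nonneg fun ω => sq_nonneg _
  have hkR : (0 : ℝ) < k := by positivity
  have : NeZero N := ⟨by omega⟩
  have hlt : ∀ i ∈ delayWindow τ t, i < m := fun i hi => (mem_delayWindow.1 hi).1.trans ht
  have hsq : ∀ i ∈ delayWindow τ t, Integrable (fun ω => move z i ω ^ 2) μ := fun i hi =>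
    ((h.finite_move i (hlt i hi)).comp fun r => r ^ 2).integrable
  have hcard : (delayWindow τ t).card ≤ τ := by
    rw [delayWindow, Nat.card_Ico]
    omega
  have hwin : ∫ ω, (∑ i ∈ delayWindow τ t, move z i ω) ^ 2 ∂μ ≤ τ * geomSum ρ τ / k * V := by
    calc ∫ ω, (∑ i ∈ delayWindow τ t, move z i ω) ^ 2 ∂μ
        ≤ ∫ ω, τ * ∑ i ∈ delayWindow τ t, move z i ω ^ 2 ∂μ := by
          refine integral_mono ((FiniteValued.sum fun i hi => h.finite_move i
            (hlt i hi)).comp fun r => r ^ 2).integrable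
            ((integrable_finsetSum _ hsq).const_mul _) fun ω => ?_
          refine sq_sum_le_card_mul_sum_sq.trans (mul_le_mul_of_nonneg_right
            (by exact_mod_cast hcard) (Finset.sum_nonneg fun i _ => sq_nonneg _))
      _ = τ * ∑ i ∈ delayWindow τ t, ∫ ω, move z i ω ^ 2 ∂μ := by
          rw [integral_const_mul, integral_finsetSum _ hsq]
      _ ≤ τ * ∑ i ∈ delayWindow τ t, (k : ℝ)⁻¹ * (ρ ^ (t - i) * V) := by
          refine mul_le_mul_of_nonneg_left (Finset.sum_le_sum fun i hi => ?_) (by positivity)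
          rw [h.integral_move_sq hk (hlt i hi)]
          exact mul_le_mul_of_nonneg_left (hV i (mem_delayWindow.1 hi).1.le) (by positivity)
      _ = (τ * (k : ℝ)⁻¹ * V) * ∑ i ∈ delayWindow τ t, ρ ^ (t - i) := by
          rw [← Finset.mul_sum, ← Finset.sum_mul]
          ring
      _ ≤ (τ * (k : ℝ)⁻¹ * V) * geomSum ρ τ :=
          mul_le_mul_of_nonneg_left
            (sum_pow_delay_le hρ fun i hi => mem_delayWindow.1 hi) (by positivity)
      _ = _ := by ring
  have i1 : Integrable (fun ω => P.fReal (π (z t ω)) - P.fReal (z t ω)) μ :=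
    ((h.finite_iterate t ht.le).comp fun x => P.fReal (π x) - P.fReal x).integrable
  have i2 : Integrable (fun ω => (∑ i ∈ delayWindow τ t, move z i ω) ^ 2) μ :=
    ((FiniteValued.sum fun i hi => h.finite_move i (hlt i hi)).comp fun r => r ^ 2).integrable
  rw [h.integral_inner_vhat hk hb hbN ht π]
  calc ∫ ω, ⟪P.fullGrad (zhat t ω), π (z t ω) - z t ω⟫_ℝ ∂μ
      ≤ ∫ ω, (P.fReal (π (z t ω)) - P.fReal (z t ω))
          + Lmax / 2 * (∑ i ∈ delayWindow τ t, move z i ω) ^ 2 ∂μ := by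
        refine integral_mono ((h.finite_state ht).comp fun y =>
          ⟪P.fullGrad y.1.2.1, π y.1.1 - y.1.1⟫_ℝ).integrable
          (i1.add (i2.const_mul (Lmax / 2))) fun ω => ?_
        exact h.inner_fullGrad_read_le hmax hLmax ht ω _
    _ = ∫ ω, (P.fReal (π (z t ω)) - P.fReal (z t ω)) ∂μ
          + Lmax / 2 * ∫ ω, (∑ i ∈ delayWindow τ t, move z i ω) ^ 2 ∂μ := by
        rw [integral_add i1 (i2.const_mul (Lmax / 2)), integral_const_mul]
    _ ≤ _ := by
        rw [mul_assoc]
        exact add_le_add_right (mul_le_mul_of_nonneg_left hwin (by linarith)) _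

end Progress
end IsInnerLoop

/-! ### Expected progress of one iteration and of one inner loop -/

namespace IsInnerLoop

variable {n k N : ℕ} {Ω : Type*} {m₀ : MeasurableSpace Ω} {μ : Measure Ω}
  [IsProbabilityMeasure μ]
  {P : Problem n k N} {c : ℝ} {m τ b : ℕ} {z zhat : ℕ → Ω → Vec n}
  {A : ℕ → Ω → Finset (Fin N)} {J : ℕ → Ω → Fin k} {Lnor Lres Lmax ρ : ℝ} {t : ℕ}

lemma integral_dist_sq_sub_le (h : IsInnerLoop μ P c m τ b z zhat A J) (hk : 0 < k) (hc : 0 < c)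
    (ht : t < m) {π : Vec n → Vec n} (hπ : ∀ x, P.Dom (π x)) :
    ∫ ω, (‖z (t + 1) ω - π (z t ω)‖ ^ 2 - ‖z t ω - π (z t ω)‖ ^ 2) ∂μ ≤ (k : ℝ)⁻¹ *
      (- (∫ ω, ‖full P c z zhat A t ω‖ ^ 2 ∂μ) + 2 * c *
        ((∫ ω, ⟪P.vhat (A t ω) (zhat t ω) (z 0 ω), π (z t ω) - z t ω⟫_ℝ ∂μ)
        - (∫ ω, ⟪P.vhat (A t ω) (zhat t ω) (z 0 ω), full P c z zhat A t ω⟫_ℝ ∂μ)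
        + (∫ ω, P.gReal (π (z t ω)) ∂μ) - ∫ ω, P.gReal (z t ω + full P c z zhat A t ω) ∂μ)) := by
  have hY := h.finite_state ht
  have i0 := (hY.comp fun y => ‖P.vrStep c y.2 y.1.1 y.1.2.1 y.1.2.2‖ ^ 2).integrable (μ := μ)
  have i1 := (hY.comp fun y => ⟪P.vhat y.2 y.1.2.1 y.1.2.2, π y.1.1 - y.1.1⟫_ℝ).integrable (μ := μ)
  have i2 := (hY.comp fun y => ⟪P.vhat y.2 y.1.2.1 y.1.2.2,
    P.vrStep c y.2 y.1.1 y.1.2.1 y.1.2.2⟫_ℝ).integrable (μ := μ)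
  have i3 := (hY.comp fun y => P.gReal (π y.1.1)).integrable (μ := μ)
  have i4 := (hY.comp fun y =>
    P.gReal (y.1.1 + P.vrStep c y.2 y.1.1 y.1.2.1 y.1.2.2)).integrable (μ := μ)
  have hlin := (integral_add i0.neg (((((i1.sub i2).add i3).sub i4)).const_mul (2 * c)))
  have hlin2 := integral_sub ((i1.sub i2).add i3) i4
  have hlin3 := integral_add (i1.sub i2) i3
  have hlin4 := integral_sub i1 i2
  have hlin5 := integral_neg (μ := μ)
    (fun ω => ‖P.vrStep c (A t ω) (z t ω) (zhat t ω) (z 0 ω)‖ ^ 2)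
  simp only [Pi.add_apply, Pi.sub_apply, Pi.neg_apply] at hlin hlin2 hlin3 hlin4 hlin5
  rw [integral_const_mul, hlin2, hlin3, hlin4, hlin5] at hlin
  simp only [h.step t ht]
  refine (h.integral_draw_block hk ht (fun y S j =>
    ‖y.1 + P.blk j (P.vrStep c S y.1 y.2.1 y.2.2) - π y.1‖ ^ 2 - ‖y.1 - π y.1‖ ^ 2)).trans_le ?_
  refine mul_le_mul_of_nonneg_left ?_ (by positivity)
  refine (integral_mono_ae (hY.comp fun y => ∑ j,
    (‖y.1.1 + P.blk j (P.vrStep c y.2 y.1.1 y.1.2.1 y.1.2.2) - π y.1.1‖ ^ 2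
      - ‖y.1.1 - π y.1.1‖ ^ 2)).integrable
    (i0.neg.add (((((i1.sub i2).add i3).sub i4)).const_mul (2 * c))) ?_).trans_eq hlin
  filter_upwards [h.solvable t ht] with ω hω
  exact Problem.sum_norm_add_blk_fullStep_le hc hω (hπ _)

lemma integral_FReal_sub_le (h : IsInnerLoop μ P c m τ b z zhat A J) (hk : 0 < k) [NeZero N]
    (hnor : P.NormalLipschitz Lnor) (ht : t < m) :
    ∫ ω, (P.FReal (z (t + 1) ω) - P.FReal (z t ω)) ∂μ ≤ (k : ℝ)⁻¹ *
      ((∫ ω, ⟪P.fullGrad (z t ω), full P c z zhat A t ω⟫_ℝ ∂μ)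
        + Lnor / 2 * (∫ ω, ‖full P c z zhat A t ω‖ ^ 2 ∂μ)
        + (∫ ω, P.gReal (z t ω + full P c z zhat A t ω) ∂μ) - ∫ ω, P.gReal (z t ω) ∂μ) := by
  have hY := h.finite_state ht
  have i0 := (hY.comp fun y => ‖P.vrStep c y.2 y.1.1 y.1.2.1 y.1.2.2‖ ^ 2).integrable (μ := μ)
  have i1 := (hY.comp fun y => ⟪P.fullGrad y.1.1,
    P.vrStep c y.2 y.1.1 y.1.2.1 y.1.2.2⟫_ℝ).integrable (μ := μ)
  have i2 := (hY.comp fun y =>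
    P.gReal (y.1.1 + P.vrStep c y.2 y.1.1 y.1.2.1 y.1.2.2)).integrable (μ := μ)
  have i3 := (hY.comp fun y => P.gReal y.1.1).integrable (μ := μ)
  have hlin := integral_sub ((i1.add (i0.const_mul (Lnor / 2))).add i2) i3
  have hlin2 := integral_add (i1.add (i0.const_mul (Lnor / 2))) i2
  have hlin3 := integral_add i1 (i0.const_mul (Lnor / 2))
  simp only [Pi.add_apply] at hlin hlin2 hlin3
  rw [hlin2, hlin3, integral_const_mul] at hlin
  simp only [h.step t ht]
  refine (h.integral_draw_block hk ht (fun y S j =>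
    P.FReal (y.1 + P.blk j (P.vrStep c S y.1 y.2.1 y.2.2)) - P.FReal y.1)).trans_le ?_
  refine mul_le_mul_of_nonneg_left ?_ (by positivity)
  refine (integral_mono (hY.comp fun y => ∑ j,
    (P.FReal (y.1.1 + P.blk j (P.vrStep c y.2 y.1.1 y.1.2.1 y.1.2.2))
      - P.FReal y.1.1)).integrable
    (((i1.add (i0.const_mul (Lnor / 2))).add i2).sub i3) fun ω => ?_).trans_eq hlin
  simp only [Pi.add_apply, Pi.sub_apply]
  set U := P.vrStep c (A t ω) (z t ω) (zhat t ω) (z 0 ω)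
  have h1 : ∀ j, P.FReal (z t ω + P.blk j U) - P.FReal (z t ω) ≤
      ⟪P.fullGrad (z t ω), P.blk j U⟫_ℝ + Lnor / 2 * ‖P.blk j U‖ ^ 2
        + (P.gReal (z t ω + P.blk j U) - P.gReal (z t ω)) := fun j => by
    have := hnor.fReal_add_le (z t ω) (P.blk j U)
    simp only [Problem.FReal]
    linarith
  refine (Finset.sum_le_sum fun j _ => h1 j).trans (le_of_eq ?_)
  rw [Finset.sum_add_distrib, Finset.sum_add_distrib, ← inner_sum, ← Finset.mul_sum, P.sum_blk,
    P.sum_norm_blk_sq, Problem.sum_gReal_add_blk_sub]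
  ring

lemma integral_norm_full_sq_le (h : IsInnerLoop μ P c m τ b z zhat A J) (hc : 0 < c)
    (ht : t < m) :
    ∫ ω, ‖full P c z zhat A t ω‖ ^ 2 ∂μ ≤ c * ((∫ ω, P.gReal (z t ω) ∂μ)
      - (∫ ω, P.gReal (z t ω + full P c z zhat A t ω) ∂μ)
      - ∫ ω, ⟪P.vhat (A t ω) (zhat t ω) (z 0 ω), full P c z zhat A t ω⟫_ℝ ∂μ) := by
  have hY := h.finite_state ht
  have i0 := (hY.comp fun y => ‖P.vrStep c y.2 y.1.1 y.1.2.1 y.1.2.2‖ ^ 2).integrable (μ := μ)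
  have i1 := (hY.comp fun y => P.gReal y.1.1).integrable (μ := μ)
  have i2 := (hY.comp fun y =>
    P.gReal (y.1.1 + P.vrStep c y.2 y.1.1 y.1.2.1 y.1.2.2)).integrable (μ := μ)
  have i3 := (hY.comp fun y => ⟪P.vhat y.2 y.1.2.1 y.1.2.2,
    P.vrStep c y.2 y.1.1 y.1.2.1 y.1.2.2⟫_ℝ).integrable (μ := μ)
  have hlin := integral_sub (i1.sub i2) i3
  have hlin2 := integral_sub i1 i2
  simp only [Pi.sub_apply] at hlin hlin2
  rw [hlin2] at hlin
  have hlin3 := integral_const_mul (μ := μ) c (fun ω => P.gReal (z t ω)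
    - P.gReal (z t ω + P.vrStep c (A t ω) (z t ω) (zhat t ω) (z 0 ω))
    - ⟪P.vhat (A t ω) (zhat t ω) (z 0 ω), P.vrStep c (A t ω) (z t ω) (zhat t ω) (z 0 ω)⟫_ℝ)
  rw [hlin] at hlin3
  refine (integral_mono_ae i0 (((i1.sub i2).sub i3).const_mul c) ?_).trans_eq hlin3
  filter_upwards [h.solvable t ht] with ω hω
  exact Problem.norm_fullStep_sq_le hc hω (h.dom t ht.le ω)

/-- One iteration: neither the expected objective nor the Lyapunov function
`‖x - π x‖² + 2 c F(x)` grows, and the latter decreases by a multiple of the optimality gap. -/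
lemma one_step (h : IsInnerLoop μ P c m τ b z zhat A J) (hk : 0 < k) (hc : 0 < c) (hb : 1 ≤ b)
    (hbN : b ≤ N) (hρ : 1 < ρ) (hnor : P.NormalLipschitz Lnor) (hLnor : 0 ≤ Lnor)
    (hres : P.BlockRestrictedLipschitz Lres) (hLres : 0 ≤ Lres)
    (hmax : P.BlockCoordinateLipschitz Lmax) (hLmax : 0 ≤ Lmax)
    (hstep₁ : 4 * (1 + c * (Lres * (1 + geomSum (√ρ) τ) + Lnor * (1 + geomSum (√ρ) (m - 1)))) ≤
      √k * (1 - ρ⁻¹))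
    (hstep₂ : c * (Lnor + Lmax * (τ * geomSum ρ τ / k)
      + 2 * ((Lres * geomSum (√ρ) τ + Lnor * geomSum (√ρ) (m - 1)) / √k)) ≤ 1)
    (ht : t < m) {π : Vec n → Vec n} (hπ : ∀ x, P.Dom (π x)) :
    ∫ ω, (P.FReal (z (t + 1) ω) - P.FReal (z t ω)) ∂μ ≤ 0 ∧
    k * (∫ ω, (‖z (t + 1) ω - π (z t ω)‖ ^ 2 - ‖z t ω - π (z t ω)‖ ^ 2) ∂μ
        + 2 * c * ∫ ω, (P.FReal (z (t + 1) ω) - P.FReal (z t ω)) ∂μ) ≤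
      2 * c * ∫ ω, (P.FReal (π (z t ω)) - P.FReal (z t ω)) ∂μ := by
  have : NeZero N := ⟨by omega⟩
  have hkR : (0 : ℝ) < k := by positivity
  have hV := h.growth hk hc hb hρ hnor hLnor hres hLres hstep₁ ht
  have I1 := h.integral_dist_sq_sub_le hk hc ht hπ
  have I2 := h.integral_FReal_sub_le hk hnor ht
  have I3 := h.integral_inner_vhat_le hk hb hbN (by linarith) hmax hLmax ht hV π
  have I4 := h.integral_inner_grad_sub_vhat_le hk hb hbN (by linarith) hnor hLnor hres hLres ht hV
  have I5 := h.integral_norm_full_sq_le hc ht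
  have hV0 : 0 ≤ ∫ ω, ‖full P c z zhat A t ω‖ ^ 2 ∂μ := integral_nonneg fun ω => sq_nonneg _
  have hY := h.finite_state ht
  have hsub : ∫ ω, ⟪P.fullGrad (z t ω) - P.vhat (A t ω) (zhat t ω) (z 0 ω),
      full P c z zhat A t ω⟫_ℝ ∂μ = (∫ ω, ⟪P.fullGrad (z t ω), full P c z zhat A t ω⟫_ℝ ∂μ)
      - ∫ ω, ⟪P.vhat (A t ω) (zhat t ω) (z 0 ω), full P c z zhat A t ω⟫_ℝ ∂μ := by
    simp only [inner_sub_left]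
    exact integral_sub
      (hY.comp fun y => ⟪P.fullGrad y.1.1, P.vrStep c y.2 y.1.1 y.1.2.1 y.1.2.2⟫_ℝ).integrable
      (hY.comp fun y => ⟪P.vhat y.2 y.1.2.1 y.1.2.2,
        P.vrStep c y.2 y.1.1 y.1.2.1 y.1.2.2⟫_ℝ).integrable
  rw [hsub] at I4
  have hf : ∀ φ : Vec n → ℝ, Integrable (fun ω => φ (z t ω)) μ := fun φ =>
    ((h.finite_iterate t ht.le).comp φ).integrable
  have hF : ∫ ω, (P.FReal (π (z t ω)) - P.FReal (z t ω)) ∂μ =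
      ∫ ω, (P.fReal (π (z t ω)) - P.fReal (z t ω)) ∂μ
      + ((∫ ω, P.gReal (π (z t ω)) ∂μ) - ∫ ω, P.gReal (z t ω) ∂μ) := by
    rw [← integral_sub (hf fun x => P.gReal (π x)) (hf P.gReal),
      ← integral_add (hf fun x => P.fReal (π x) - P.fReal x)
        (hf fun x => P.gReal (π x) - P.gReal x)]
    congr 1
    ext ω
    simp only [Problem.FReal]
    ring
  rw [hF]
  rw [le_inv_mul_iff₀ hkR] at I1 I2
  set V := ∫ ω, ‖full P c z zhat A t ω‖ ^ 2 ∂μ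
  set T := (Lres * geomSum (√ρ) τ + Lnor * geomSum (√ρ) (m - 1)) / √k with hT
  have hT0 : 0 ≤ T := by
    have := geomSum_nonneg (Real.sqrt_nonneg ρ) τ
    have := geomSum_nonneg (Real.sqrt_nonneg ρ) (m - 1)
    positivity
  have hG0 : 0 ≤ Lmax * (τ * geomSum ρ τ / k) := by
    have := geomSum_nonneg (by linarith : 0 ≤ ρ) τ
    positivity
  have hkey := mul_le_mul_of_nonneg_right hstep₂ hV0
  refine ⟨?_, ?_⟩
  · -- The prox inequality at the current point outweighs the descent error.
    have h1 : c * (k * ∫ ω, (P.FReal (z (t + 1) ω) - P.FReal (z t ω)) ∂μ) ≤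
        (c * T + c * (Lnor / 2) - 1) * V := by
      have := mul_le_mul_of_nonneg_left I2 hc.le
      have := mul_le_mul_of_nonneg_left I4 hc.le
      linarith
    have h2 : (c * T + c * (Lnor / 2) - 1) * V ≤ 0 := by
      refine mul_nonpos_of_nonpos_of_nonneg ?_ hV0
      have := mul_nonneg hc.le hT0
      have := mul_nonneg hc.le hG0
      have := mul_nonneg hc.le hLnor
      linarith
    have h3 : c * k * ∫ ω, (P.FReal (z (t + 1) ω) - P.FReal (z t ω)) ∂μ ≤ 0 := by linarith
    exact nonpos_of_mul_nonpos_right h3 (by positivity)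
  · have h2 := mul_le_mul_of_nonneg_left I2 (by positivity : 0 ≤ 2 * c)
    have h3 := mul_le_mul_of_nonneg_left I3 (by positivity : 0 ≤ 2 * c)
    have h4 := mul_le_mul_of_nonneg_left I4 (by positivity : 0 ≤ 2 * c)
    linarith

/-- One inner loop: the expected objective does not grow, and the expected Lyapunov function
`Q + 2 c F` decreases by at least
`2 c m / k` times the expected final optimality gap. Here `Q` is the squared distance to the
target set that `π` selects points from, and `Fs` is the value of `F` there. -/
lemma inner_loop (h : IsInnerLoop μ P c m τ b z zhat A J) (hk : 0 < k) (hc : 0 < c) (hb : 1 ≤ b)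
    (hbN : b ≤ N) (hρ : 1 < ρ) (hnor : P.NormalLipschitz Lnor) (hLnor : 0 ≤ Lnor)
    (hres : P.BlockRestrictedLipschitz Lres) (hLres : 0 ≤ Lres)
    (hmax : P.BlockCoordinateLipschitz Lmax) (hLmax : 0 ≤ Lmax)
    (hstep₁ : 4 * (1 + c * (Lres * (1 + geomSum (√ρ) τ) + Lnor * (1 + geomSum (√ρ) (m - 1)))) ≤
      √k * (1 - ρ⁻¹))
    (hstep₂ : c * (Lnor + Lmax * (τ * geomSum ρ τ / k)
      + 2 * ((Lres * geomSum (√ρ) τ + Lnor * geomSum (√ρ) (m - 1)) / √k)) ≤ 1)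
    {π : Vec n → Vec n} (hπ : ∀ x, P.Dom (π x)) {Fs : ℝ} (hFs : ∀ x, P.FReal (π x) = Fs)
    {Q : Vec n → ℝ} (hQ : ∀ x, Q x = ‖x - π x‖ ^ 2) (hQle : ∀ x y, Q y ≤ ‖y - π x‖ ^ 2) :
    (∫ ω, P.FReal (z m ω) ∂μ ≤ ∫ ω, P.FReal (z 0 ω) ∂μ) ∧
    ∫ ω, Q (z m ω) ∂μ + 2 * c * (∫ ω, P.FReal (z m ω) ∂μ)
        + 2 * c * m / k * ((∫ ω, P.FReal (z m ω) ∂μ) - Fs) ≤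
      ∫ ω, Q (z 0 ω) ∂μ + 2 * c * ∫ ω, P.FReal (z 0 ω) ∂μ := by
  have hkR : (0 : ℝ) < k := by positivity
  have hi : ∀ t ≤ m, ∀ φ : Vec n → ℝ, Integrable (fun ω => φ (z t ω)) μ := fun t ht φ =>
    ((h.finite_iterate t ht).comp φ).integrable
  let q : ℕ → ℝ := fun t => ∫ ω, Q (z t ω) ∂μ
  let F : ℕ → ℝ := fun t => ∫ ω, P.FReal (z t ω) ∂μ
  have hstep : ∀ t < m, F (t + 1) ≤ F t ∧
      k * (q (t + 1) - q t + 2 * c * (F (t + 1) - F t)) ≤ 2 * c * (Fs - F t) := by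
    intro t ht
    obtain ⟨h1, h2⟩ := h.one_step hk hc hb hbN hρ hnor hLnor hres hLres hmax hLmax hstep₁ hstep₂
      ht hπ
    rw [integral_sub (hi _ ht P.FReal) (hi _ ht.le P.FReal)] at h1 h2
    simp only [hFs] at h2
    rw [integral_sub (integrable_const _) (hi _ ht.le P.FReal), integral_const, probReal_univ,
      one_smul] at h2
    have h3 : q (t + 1) - q t ≤
        ∫ ω, (‖z (t + 1) ω - π (z t ω)‖ ^ 2 - ‖z t ω - π (z t ω)‖ ^ 2) ∂μ := by
      rw [← integral_sub (hi _ ht Q) (hi _ ht.le Q)]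
      refine integral_mono ((hi _ ht Q).sub (hi _ ht.le Q))
        (((h.finite_iterate (t + 1) ht).prodMk (h.finite_iterate t ht.le)).comp fun y =>
          ‖y.1 - π y.2‖ ^ 2 - ‖y.2 - π y.2‖ ^ 2).integrable fun ω => ?_
      simp only [hQ (z t ω)]
      exact sub_le_sub_right (hQle _ _) _
    refine ⟨by simpa only [F, sub_nonpos] using h1, le_trans ?_ h2⟩
    exact mul_le_mul_of_nonneg_left (add_le_add_left h3 _) hkR.le
  have hmono : ∀ t ≤ m, F m ≤ F t := by
    intro t ht
    exact Nat.decreasingInduction' (P := fun t => F m ≤ F t)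
      (fun i hi _ ih => ih.trans (hstep i hi).1) ht le_rfl
  have hsum : ∀ t ≤ m, k * (q t - q 0 + 2 * c * (F t - F 0)) ≤ 2 * c * t * (Fs - F m) := by
    intro t
    induction t with
    | zero => intro _; simp
    | succ t ih =>
      intro ht
      have h1 := ih (by omega)
      have h2 := (hstep t ht).2
      have h3 := mul_le_mul_of_nonneg_left (hmono t (by omega)) (by positivity : 0 ≤ 2 * c)
      push_cast
      linarith
  have hfin := hsum m le_rfl
  refine ⟨hmono 0 (Nat.zero_le m), ?_⟩
  have h4 : 2 * c * m / k * (F m - Fs) = (2 * c * m * (F m - Fs)) / k := by ring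
  change q m + 2 * c * F m + 2 * c * m / k * (F m - Fs) ≤ q 0 + 2 * c * F 0
  have h5 : (2 * c * m * (F m - Fs)) / k ≤ q 0 + 2 * c * F 0 - (q m + 2 * c * F m) := by
    rw [div_le_iff₀ hkR]
    linarith
  linarith

end IsInnerLoop

/-! ### The solution set -/

namespace Problem

variable {n k N : ℕ} {P : Problem n k N}

lemma lowerSemicontinuous_F (P : Problem n k N) : LowerSemicontinuous P.F := by
  have hg : ∀ S : Finset (Fin k), LowerSemicontinuous fun x => ∑ j ∈ S, P.g j (P.part j x) := by
    intro S
    induction S using Finset.induction_on with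
    | empty => simpa using lowerSemicontinuous_const
    | insert j S hj ih =>
      simp only [Finset.sum_insert hj]
      exact ((P.g_closed j).comp (P.continuous_part j)).add' ih fun x =>
        EReal.continuousAt_add (.inr (sum_g_ne_bot S x)) (.inl (P.g_ne_bot j _))
  have hf : Continuous P.fReal := continuous_iff_continuousAt.2 fun x =>
    (P.hasGradientAt_fReal x).differentiableAt.continuousAt
  exact (continuous_coe_real_ereal.comp hf).lowerSemicontinuous.add' (hg _) fun x =>
    EReal.continuousAt_add (.inl (EReal.coe_ne_top _)) (.inl (EReal.coe_ne_bot _))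

lemma coe_Fstar (hS : P.sol.Nonempty) : (P.Fstar : EReal) = ⨅ x, P.F x := by
  obtain ⟨p, hp, he⟩ := hS
  rw [Fstar, EReal.coe_toReal]
  · rwa [← he]
  · rw [← he]
    exact F_ne_bot p

lemma isClosed_sol (hS : P.sol.Nonempty) : IsClosed P.sol := by
  have h : P.sol = P.F ⁻¹' Set.Iic (⨅ x, P.F x) := by
    ext x
    refine ⟨fun hx => hx.2.le, fun hx => ?_⟩
    have he : P.F x = ⨅ y, P.F y := le_antisymm hx (iInf_le _ x)
    refine ⟨?_, he⟩
    rw [he, ← coe_Fstar hS]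
    exact EReal.coe_ne_top _
  rw [h]
  exact P.lowerSemicontinuous_F.isClosed_preimage _

lemma dom_of_mem_sol {p : Vec n} (hp : p ∈ P.sol) : P.Dom p := dom_of_F_ne_top hp.1

lemma FReal_of_mem_sol {p : Vec n} (hp : p ∈ P.sol) : P.FReal p = P.Fstar := by
  have h := hp.2
  rw [F_eq_coe (dom_of_mem_sol hp), ← coe_Fstar ⟨p, hp⟩] at h
  exact_mod_cast h

/-- Every point has a Euclidean projection onto the solution set. -/
lemma exists_projection (hS : P.sol.Nonempty) : ∃ π : Vec n → Vec n,
    ∀ x, π x ∈ P.sol ∧ Metric.infDist x P.sol = ‖x - π x‖ := by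
  choose π h1 h2 using fun x => (isClosed_sol hS).exists_infDist_eq_dist hS x
  exact ⟨π, fun x => ⟨h1 x, by rw [h2 x, dist_eq_norm]⟩⟩

lemma infDist_of_isProj {x p : Vec n} (hp : IsProj P.sol x p) :
    Metric.infDist x P.sol = ‖x - p‖ := by
  refine le_antisymm ?_ ?_
  · rw [← dist_eq_norm]
    exact Metric.infDist_le_dist_of_mem hp.1
  · refine (Metric.le_infDist ⟨p, hp.1⟩).2 fun q hq => ?_
    rw [dist_eq_norm]
    exact hp.2 q hq

lemma OptStrongConvex.le_FReal_sub {l : ℝ} (h : P.OptStrongConvex l) (hS : P.sol.Nonempty)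
    {x : Vec n} (hx : P.Dom x) :
    l / 2 * Metric.infDist x P.sol ^ 2 ≤ P.FReal x - P.Fstar := by
  obtain ⟨π, hπ⟩ := exists_projection hS
  have hproj : IsProj P.sol x (π x) := ⟨(hπ x).1, fun q hq => by
    rw [← (hπ x).2, ← dist_eq_norm]
    exact Metric.infDist_le_dist_of_mem hq⟩
  have h1 := h x (π x) hproj
  rw [F_eq_coe (dom_of_mem_sol (hπ x).1), FReal_of_mem_sol (hπ x).1, F_eq_coe hx] at h1
  have h2 : P.Fstar + l / 2 * ‖x - π x‖ ^ 2 ≤ P.FReal x := by exact_mod_cast h1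
  rw [(hπ x).2]
  linarith

lemma NormalLipschitz.nonneg {L : ℝ} (h : P.NormalLipschitz L) (hn : 0 < n) (hN : 0 < N) :
    0 ≤ L := by
  have h1 := h ⟨0, hN⟩ (EuclideanSpace.single ⟨0, hn⟩ 1) 0
  rw [sub_zero, PiLp.norm_single, norm_one, mul_one] at h1
  exact (norm_nonneg _).trans h1

lemma BlockRestrictedLipschitz.nonneg {L : ℝ} (h : P.BlockRestrictedLipschitz L) (hn : 0 < n)
    (hN : 0 < N) : 0 ≤ L := by
  have hs : P.SupportedOn (P.block ⟨0, hn⟩) (EuclideanSpace.single ⟨0, hn⟩ 1) := by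
    intro c hc
    have : c ≠ ⟨0, hn⟩ := fun e => hc (by rw [e])
    simp [this]
  have h1 := h ⟨0, hN⟩ _ 0 _ hs
  rw [P.norm_part_of_supportedOn hs, PiLp.norm_single, norm_one, mul_one] at h1
  exact (norm_nonneg _).trans h1

end Problem

/-! ### Rates from the recursion over outer loops -/

section Rates

variable {q F : ℕ → ℝ} {c a Fs : ℝ}

/-- The Lyapunov function contracts by a constant factor under a quadratic growth bound. -/
lemma linear_rate (hc : 0 < c) (ha : 0 ≤ a) {l : ℝ} (hl : 0 < l)
    (hrec : ∀ s, q (s + 1) + 2 * c * F (s + 1) + 2 * c * a * (F (s + 1) - Fs) ≤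
      q s + 2 * c * F s) (hq : ∀ s, 0 ≤ q s) (hgrow : ∀ s, l / 2 * q s ≤ F s - Fs) (s : ℕ) :
    F s - Fs ≤ 1 / (2 * c) * (1 / (1 + c * a * l / (1 + c * l))) ^ s *
      (q 0 + 2 * c * (F 0 - Fs)) := by
  set r := 1 + c * a * l / (1 + c * l) with hr
  have hr0 : 0 < r := by positivity
  have hΦ : ∀ s, q s + 2 * c * (F s - Fs) ≤ (1 / r) ^ s * (q 0 + 2 * c * (F 0 - Fs)) := by
    intro s
    induction s with
    | zero => simp
    | succ s ih =>
      have h1 : l * (q (s + 1) + 2 * c * (F (s + 1) - Fs)) ≤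
          2 * (1 + c * l) * (F (s + 1) - Fs) := by
        have := hgrow (s + 1)
        linarith
      have h2 : r * (q (s + 1) + 2 * c * (F (s + 1) - Fs)) ≤ q s + 2 * c * (F s - Fs) := by
        have h3 : c * a * l / (1 + c * l) * (q (s + 1) + 2 * c * (F (s + 1) - Fs)) ≤
            2 * c * a * (F (s + 1) - Fs) := by
          rw [div_mul_eq_mul_div, div_le_iff₀ (by positivity)]
          have := mul_le_mul_of_nonneg_left h1 (by positivity : 0 ≤ c * a)
          linarith
        have := hrec s
        rw [hr]
        linarith
      refine le_of_mul_le_mul_left ?_ hr0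
      calc r * (q (s + 1) + 2 * c * (F (s + 1) - Fs)) ≤ q s + 2 * c * (F s - Fs) := h2
        _ ≤ (1 / r) ^ s * (q 0 + 2 * c * (F 0 - Fs)) := ih
        _ = r * ((1 / r) ^ (s + 1) * (q 0 + 2 * c * (F 0 - Fs))) := by
          rw [pow_succ]
          field_simp
  have h := hΦ s
  rw [mul_assoc, one_div_mul_eq_div, le_div_iff₀ (by positivity)]
  linarith [hq s]

lemma sublinear_rate (hc : 0 < c) (ha : 0 ≤ a)
    (hrec : ∀ s, q (s + 1) + 2 * c * F (s + 1) + 2 * c * a * (F (s + 1) - Fs) ≤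
      q s + 2 * c * F s) (hq : ∀ s, 0 ≤ q s) (hmono : ∀ s, F (s + 1) ≤ F s) (s : ℕ) :
    (2 * c + 2 * c * a * s) * (F s - Fs) ≤ q 0 + 2 * c * (F 0 - Fs) := by
  have hsum : ∀ s : ℕ, q s + (2 * c + 2 * c * a * s) * (F s - Fs) ≤
      q 0 + 2 * c * (F 0 - Fs) := by
    intro s
    induction s with
    | zero => simp
    | succ s ih =>
      have h1 := hrec s
      have h2 := mul_le_mul_of_nonneg_left (hmono s) (by positivity : 0 ≤ 2 * c * a * s)
      push_cast
      linarith
  linarith [hsum s, hq s]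

end Rates

/-! ### The recursion over outer loops -/

namespace IsRun

variable {n k N : ℕ} {Ω : Type*} {m₀ : MeasurableSpace Ω} {μ : Measure Ω}
  [IsProbabilityMeasure μ] {ℱ : Filtration ℕ m₀} {P : Problem n k N}
  {Lnor Lres Lmax γ ρ : ℝ} {m τ b : ℕ} {x0 : Vec n} {xs : ℕ → Ω → Vec n}
  {x xhat : ℕ → ℕ → Ω → Vec n} {batch : ℕ → ℕ → Ω → Finset (Fin N)} {coord : ℕ → ℕ → Ω → Fin k}

lemma outer_recursion (hrun : IsRun μ ℱ P Lmax γ m τ b x0 xs x xhat batch coord) (hk : 0 < k)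
    (hb : 1 ≤ b) (hbN : b ≤ N) (hnor : P.NormalLipschitz Lnor)
    (hres : P.BlockRestrictedLipschitz Lres) (hmax : P.BlockCoordinateLipschitz Lmax)
    (hLmax : 0 < Lmax) (hx0 : P.Dom x0) (hS : P.sol.Nonempty) (hγ : 0 < γ) (hρ : 1 < ρ)
    (hstep₁ : 4 * γ * (Lres / Lmax * (1 + theta1 ρ τ) + Lnor / Lmax * (1 + theta2 ρ m)) ≤
      √(k : ℝ) * (1 - ρ⁻¹) - 4)
    (hstep₂ : 0 ≤ 1 - Lnor / Lmax * γ - γ * τ * theta' ρ τ / k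
      - 2 * (Lres / Lmax * theta1 ρ τ + Lnor / Lmax * theta2 ρ m) * γ / √(k : ℝ)) (s : ℕ) :
    (∫ ω, P.FReal (xs (s + 1) ω) ∂μ ≤ ∫ ω, P.FReal (xs s ω) ∂μ) ∧
    ∫ ω, Metric.infDist (xs (s + 1) ω) P.sol ^ 2 ∂μ
        + 2 * (γ / Lmax) * (∫ ω, P.FReal (xs (s + 1) ω) ∂μ)
        + 2 * (γ / Lmax) * (m / k) * ((∫ ω, P.FReal (xs (s + 1) ω) ∂μ) - P.Fstar) ≤
      ∫ ω, Metric.infDist (xs s ω) P.sol ^ 2 ∂μ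
        + 2 * (γ / Lmax) * ∫ ω, P.FReal (xs s ω) ∂μ := by
  have hc : 0 < γ / Lmax := by positivity
  rcases Nat.eq_zero_or_pos m with rfl | hm
  · have he : xs (s + 1) = xs s := by
      ext1 ω
      rw [hrun.outer_step, hrun.inner_start]
    rw [he]
    simp
  rcases Nat.eq_zero_or_pos n with rfl | hn
  · -- On a trivial space the constants `Lnor` and `Lres` may be negative, but nothing moves.
    have he : ∀ y : Vec 0, y ∈ P.sol := fun y => by
      obtain ⟨p, hp⟩ := hS
      rwa [Subsingleton.elim y p]
    have h1 : ∀ y : Vec 0, P.FReal y = P.Fstar := fun y => Problem.FReal_of_mem_sol (he y)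
    have h2 : ∀ y : Vec 0, Metric.infDist y P.sol = 0 := fun y =>
      Metric.infDist_zero_of_mem (he y)
    simp [h1, h2]
  have hN : 0 < N := by omega
  obtain ⟨M, rfl⟩ : ∃ M, m = M + 1 := ⟨m - 1, by omega⟩
  rw [theta1_eq hρ, theta2_eq hρ] at hstep₁ hstep₂
  rw [theta'_eq hρ] at hstep₂
  have hloop := hrun.isInnerLoop hc hx0 s
  obtain ⟨π, hπ⟩ := Problem.exists_projection hS
  have h := hloop.inner_loop hk hc hb hbN hρ hnor (hnor.nonneg hn hN) hres (hres.nonneg hn hN)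
    hmax hLmax.le (by
      rw [Nat.add_sub_cancel]
      have e : 4 * (1 + γ / Lmax * (Lres * (1 + geomSum (√ρ) τ) + Lnor * (1 + geomSum (√ρ) M)))
          = 4 * γ * (Lres / Lmax * (1 + geomSum (√ρ) τ) + Lnor / Lmax * (1 + geomSum (√ρ) M))
            + 4 := by ring
      rw [e]
      linarith) (by
      rw [Nat.add_sub_cancel]
      have e : γ / Lmax * (Lnor + Lmax * (τ * geomSum ρ τ / k)
          + 2 * ((Lres * geomSum (√ρ) τ + Lnor * geomSum (√ρ) M) / √k))
          = Lnor / Lmax * γ + γ * τ * geomSum ρ τ / k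
            + 2 * (Lres / Lmax * geomSum (√ρ) τ + Lnor / Lmax * geomSum (√ρ) M) * γ / √k := by
        field_simp
      rw [e]
      linarith) (fun x => Problem.dom_of_mem_sol (hπ x).1)
    (fun x => Problem.FReal_of_mem_sol (hπ x).1)
    (Q := fun x => Metric.infDist x P.sol ^ 2) (fun x => by rw [(hπ x).2]) (fun x y => by
      refine pow_le_pow_left₀ Metric.infDist_nonneg ?_ 2
      rw [← dist_eq_norm]
      exact Metric.infDist_le_dist_of_mem (hπ x).1)
  simp only [hrun.inner_start, ← hrun.outer_step] at h
  rwa [mul_div_assoc (2 * (γ / Lmax))] at h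

end IsRun

end AsySBCDVR

end

open AsySBCDVR in
theorem theorem1 {n k N : ℕ} {Ω : Type*} {m₀ : MeasurableSpace Ω} (μ : Measure Ω)
    [IsProbabilityMeasure μ] (ℱ : Filtration ℕ m₀) (P : Problem n k N)
    (Lnor Lres Lmax γ ρ : ℝ) (m τ b : ℕ) (x0 p0 : Vec n)
    (xs : ℕ → Ω → Vec n) (x xhat : ℕ → ℕ → Ω → Vec n)
    (batch : ℕ → ℕ → Ω → Finset (Fin N)) (coord : ℕ → ℕ → Ω → Fin k)
    (hb : 1 ≤ b) (hbN : b ≤ N)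
    (hnor : P.NormalLipschitz Lnor) (hres : P.BlockRestrictedLipschitz Lres)
    (hmax : P.BlockCoordinateLipschitz Lmax) (hLmax : 0 < Lmax)
    (hx0 : P.F x0 ≠ ⊤) (hS : P.sol.Nonempty) (hp0 : IsProj P.sol x0 p0)
    (hγ : 0 < γ) (hρ : 1 < ρ)
    (hrun : IsRun μ ℱ P Lmax γ m τ b x0 xs x xhat batch coord)
    (hstep₁ : 4 * γ * (Lres / Lmax * (1 + theta1 ρ τ) + Lnor / Lmax * (1 + theta2 ρ m)) ≤
      √(k : ℝ) * (1 - ρ⁻¹) - 4)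
    (hstep₂ : 0 ≤ 1 - Lnor / Lmax * γ - γ * τ * theta' ρ τ / k
      - 2 * (Lres / Lmax * theta1 ρ τ + Lnor / Lmax * theta2 ρ m) * γ / √(k : ℝ)) :
    (∀ s, (∀ᵐ ω ∂μ, P.F (xs s ω) ≠ ⊤) ∧ Integrable (fun ω => (P.F (xs s ω)).toReal) μ) ∧
    (∀ l : ℝ, 0 < l → P.OptStrongConvex l → ∀ s : ℕ,
      (∫ ω, (P.F (xs s ω)).toReal ∂μ) - P.Fstar ≤
        Lmax / (2 * γ) * (1 / (1 + 2 * m * γ * l / (2 * k * (l * γ + Lmax)))) ^ s *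
          (‖x0 - p0‖ ^ 2 + 2 * γ / Lmax * ((P.F x0).toReal - P.Fstar))) ∧
    (∀ s : ℕ,
      (∫ ω, (P.F (xs s ω)).toReal ∂μ) - P.Fstar ≤
        (k * Lmax * ‖x0 - p0‖ ^ 2 + 2 * γ * k * ((P.F x0).toReal - P.Fstar)) /
          (2 * γ * k + 2 * m * γ * s)) := by
  have hc : 0 < γ / Lmax := by positivity
  have hk : 0 < k := by
    obtain ⟨ω⟩ : Nonempty Ω := nonempty_of_isProbabilityMeasure μ
    exact (Nat.zero_le _).trans_lt (coord 0 0 ω).2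
  have hkR : (0 : ℝ) < k := by positivity
  have hdom0 := Problem.dom_of_F_ne_top hx0
  have hdom : ∀ s ω, P.Dom (xs s ω) := fun s ω => by
    rw [← hrun.inner_start]
    exact hrun.dom hc hdom0 ω s 0 (Nat.zero_le m)
  have hfin : ∀ s, FiniteValued m₀ (xs s) := fun s => by
    rw [← show x s 0 = xs s from funext fun ω => hrun.inner_start s ω]
    exact (hrun.isInnerLoop hc hdom0 s).finite_iterate 0 (Nat.zero_le m)
  have hF : ∀ s ω, (P.F (xs s ω)).toReal = P.FReal (xs s ω) := fun s ω =>
    Problem.toReal_F (hdom s ω)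
  let q : ℕ → ℝ := fun s => ∫ ω, Metric.infDist (xs s ω) P.sol ^ 2 ∂μ
  let F : ℕ → ℝ := fun s => ∫ ω, P.FReal (xs s ω) ∂μ
  have hrec := hrun.outer_recursion hk hb hbN hnor hres hmax hLmax hdom0 hS hγ hρ hstep₁ hstep₂
  have hq : ∀ s, 0 ≤ q s := fun s => integral_nonneg fun ω => sq_nonneg _
  have hq0 : q 0 = ‖x0 - p0‖ ^ 2 := by
    simp [q, hrun.start, Problem.infDist_of_isProj hp0]
  have hF0 : F 0 = P.FReal x0 := by simp [F, hrun.start]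
  refine ⟨fun s => ⟨Filter.Eventually.of_forall fun ω =>
    Problem.dom_iff_F_ne_top.1 (hdom s ω), ((hfin s).comp fun y => (P.F y).toReal).integrable⟩,
    fun l hl hconv s => ?_, fun s => ?_⟩
  · have h := linear_rate (q := q) (F := F) (Fs := P.Fstar) hc (by positivity : 0 ≤ (m / k : ℝ))
      hl (fun s => (hrec s).2) hq (fun s => by
        have h1 : Integrable (fun ω => P.FReal (xs s ω)) μ := ((hfin s).comp P.FReal).integrable
        have h2 : F s - P.Fstar = ∫ ω, (P.FReal (xs s ω) - P.Fstar) ∂μ := by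
          rw [integral_sub h1 (integrable_const _), integral_const, probReal_univ, one_smul]
        rw [h2, ← integral_const_mul]
        exact integral_mono
          ((hfin s).comp fun y => l / 2 * Metric.infDist y P.sol ^ 2).integrable
          (h1.sub (integrable_const _)) fun ω => hconv.le_FReal_sub hS (hdom s ω)) s
    rw [hq0, hF0] at h
    simp only [hF, Problem.toReal_F hdom0]
    refine h.trans_eq ?_
    congr 1
    · congr 1
      · field_simp
      · congr 3
        field_simp
        ring
    · ring
  · have h := sublinear_rate (q := q) (F := F) (Fs := P.Fstar) hc
      (by positivity : 0 ≤ (m / k : ℝ)) (fun s => (hrec s).2) hq (fun s => (hrec s).1) s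
    rw [hq0, hF0] at h
    simp only [hF, Problem.toReal_F hdom0]
    rw [le_div_iff₀ (by positivity)]
    have h1 := mul_le_mul_of_nonneg_left h (by positivity : 0 ≤ k * Lmax)
    have e1 : k * Lmax * ((2 * (γ / Lmax) + 2 * (γ / Lmax) * (m / k) * s) * (F s - P.Fstar))
        = (F s - P.Fstar) * (2 * γ * k + 2 * m * γ * s) := by
      field_simp
    have e2 : k * Lmax * (‖x0 - p0‖ ^ 2 + 2 * (γ / Lmax) * (P.FReal x0 - P.Fstar))
        = k * Lmax * ‖x0 - p0‖ ^ 2 + 2 * γ * k * (P.FReal x0 - P.Fstar) := by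
      field_simp
    rw [e1, e2] at h1
    exact h1
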